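/- Let $\mathcal X,\mathcal Y$ be standard Borel spaces (for instance countable sets or Euclidean spaces) and let $(X,Y)$ have an arbitrary joint law on $\mathcal X\times\mathcal Y$, with marginals $p(x),p(y)$ and regular conditional laws $p(y|x)$, $p(x|y)$. A representation $Z$ of $X$ is given by a Markov kernel $p(z|x)$ from $\mathcal X$ to a measurable space, with $Z$ conditionally independent of $Y$ given $X$ (the Markov chain $Z-X-Y$). Information quantities take values in $[0,\infty]$, and $1/\infty=0$, $1/0=\infty$, $\inf\emptyset=\infty$; suprema are taken in $[0,\infty]$, so $\sup\emptyset=0$. Define the following. - For $\beta\in\mathbb R$, $(X,Y)$ is $\mathrm{IB}_\beta$-learnable if there is a representation $Z$ with $I(X;Z)<\infty$ for which $I(X;Z)-\beta I(Y;Z)$ is strictly smaller than its value at the trivial representation $p(z|x)=p(z)$ (where $Z$ is independent of $X$). The learnability threshold is $\beta_0=\inf\{\beta:(X,Y)\text{ is }\mathrm{IB}_\beta\text{-learnable}\}$. - The hypercontractivity coefficient is $\xi(X;Y)=\sup_{Z-X-Y} I(Y;Z)/I(X;Z)$, over representations $Z$ with $0<I(X;Z)<\infty$. - The KL contraction coefficient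 is $\eta_{\mathrm{KL}}=\sup_{r} D_{\mathrm{KL}}(r(y)\|p(y))/D_{\mathrm{KL}}(r(x)\|p(x))$, over probability laws $r(x)\ne p(x)$ on $\mathcal X$ with $D_{\mathrm{KL}}(r(x)\|p(x))<\infty$, where $r(y)=\mathbb E_{x\sim r(x)}[p(y|x)]$. - For $h:\mathcal X\to\mathbb R$ with $\mathbb E[h(X)^2]<\infty$ that is not almost surely constant, $$\beta_0[h]=\frac{\mathbb E_{x\sim p(x)}[h(x)^2]-(\mathbb E_{x\sim p(x)}[h(x)])^2}{\mathbb E_{y\sim p(y)}\big[(\mathbb E_{x\sim p(x|y)}[h(x)])^2\big]-(\mathbb E_{x\sim p(x)}[h(x)])^2},$$ with $\beta_0[h]=\infty$ if the denominator is $0$. - The Hirschfeld–Gebelein–Rényi maximal correlation is $\rho_m(X;Y)=\sup_{f,g}\mathbb E[f(X)g(Y)]$, over real functions $f,g$ with $\mathbb E[f(X)]=\mathbb E[g(Y)]=0$ and $\mathbb E[f(X)^2]=\mathbb E[g(Y)^2]=1$ (and $\rho_m=0$ if there are none). Then $$\frac1{\beta_0}=\xi(X;Y)=\eta_{\mathrm{KL}}\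 \ge\ \sup_h\frac1{\beta_0[h]}=\rho_m^2(X;Y),$$ where the supremum is over all $h$ as above. -/

import Mathlib

open MeasureTheory ProbabilityTheory InformationTheory
open scoped ENNReal

noncomputable section

namespace InfoBottleneck

/-- Mutual information of a pair of random variables with joint law `Q`: the Kullback-Leibler
divergence of the joint law from the product of its marginals. -/
def mutualInfo {α β : Type*} [MeasurableSpace α] [MeasurableSpace β] (Q : Measure (α × β)) :
    ℝ≥0∞ :=
  klDiv Q (Q.fst.prod Q.snd)

section Representation

variable {𝒳 𝒴 𝒵 : Type*} [MeasurableSpace 𝒳] [MeasurableSpace 𝒴] [MeasurableSpace 𝒵]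

/-- The law of `((X, Y), Z)` where `(X, Y)` has law `P` and, given `(X, Y) = (x, y)`, the variable
`Z` has law `κ x = p(z|x)`; thus `Z - X - Y` is a Markov chain. -/
def jointLaw (P : Measure (𝒳 × 𝒴)) (κ : Kernel 𝒳 𝒵) : Measure ((𝒳 × 𝒴) × 𝒵) :=
  P ⊗ₘ κ.prodMkRight 𝒴

/-- `I(X;Z)` for the representation `Z` given by `p(z|x) = κ`. -/
def infoXZ (P : Measure (𝒳 × 𝒴)) (κ : Kernel 𝒳 𝒵) : ℝ≥0∞ :=
  mutualInfo ((jointLaw P κ).map fun w ↦ (w.1.1, w.2))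

/-- `I(Y;Z)` for the representation `Z` given by `p(z|x) = κ`. -/
def infoYZ (P : Measure (𝒳 × 𝒴)) (κ : Kernel 𝒳 𝒵) : ℝ≥0∞ :=
  mutualInfo ((jointLaw P κ).map fun w ↦ (w.1.2, w.2))

/-- The information bottleneck objective `I(X;Z) - β I(Y;Z)`. It is used only for representations
with `I(X;Z) < ∞`; for these `I(Y;Z) < ∞` as well, since `I(Y;Z) ≤ I(X;Z)`. -/
def ibObjective (P : Measure (𝒳 × 𝒴)) (β : ℝ) (κ : Kernel 𝒳 𝒵) : ℝ :=
  (infoXZ P κ).toReal - β * (infoYZ P κ).toReal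

end Representation

section Coefficients

variable {𝒳 𝒴 : Type*} [MeasurableSpace 𝒳] [MeasurableSpace 𝒴]

/-- `(X, Y)` is `IB_β`-learnable: some representation `p₁(z|x) = κ`, with `I(X;Z)` finite, has a
strictly smaller objective than the trivial representation `p(z|x) = p(z)`, in which `p(z)` is the
marginal law of `Z`. -/
def IBLearnable (P : Measure (𝒳 × 𝒴)) (β : ℝ) : Prop :=
  ∃ (𝒵 : Type) (_ : MeasurableSpace 𝒵) (κ : Kernel 𝒳 𝒵),
    IsMarkovKernel κ ∧ infoXZ P κ ≠ ∞ ∧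
      ibObjective P β κ < ibObjective P β (Kernel.const 𝒳 (κ ∘ₘ P.fst))

/-- The threshold `β₀`: the infimum of all `β` for which `(X, Y)` is `IB_β`-learnable, and `∞` if
there is none. (Only positive `β` can be learnable, so `ENNReal.ofReal` loses nothing.) -/
def learnabilityThreshold (P : Measure (𝒳 × 𝒴)) : ℝ≥0∞ :=
  ⨅ (β : ℝ) (_ : IBLearnable P β), ENNReal.ofReal β

/-- The hypercontractivity coefficient `ξ(X;Y) = sup I(Y;Z) / I(X;Z)`, over all representations `Z`
of `X` (so that `Z - X - Y` is a Markov chain) with `0 < I(X;Z) < ∞`. -/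
def hypercontractivityCoeff (P : Measure (𝒳 × 𝒴)) : ℝ≥0∞ :=
  ⨆ (𝒵 : Type) (_ : MeasurableSpace 𝒵) (κ : Kernel 𝒳 𝒵) (_ : IsMarkovKernel κ)
    (_ : infoXZ P κ ≠ 0) (_ : infoXZ P κ ≠ ∞), infoYZ P κ / infoXZ P κ

/-- The contraction coefficient `η_KL(p(y|x), p(x))`: the supremum of
`D_KL(r(y) ‖ p(y)) / D_KL(r(x) ‖ p(x))` over all probability measures `r(x) ≠ p(x)` with finite
`D_KL(r(x) ‖ p(x))`, where `r(y)` is the image of `r(x)` under the channel `p(y|x)`. -/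
def klContractionCoeff [StandardBorelSpace 𝒴] [Nonempty 𝒴]
    (P : Measure (𝒳 × 𝒴)) [IsFiniteMeasure P] : ℝ≥0∞ :=
  ⨆ (r : Measure 𝒳) (_ : IsProbabilityMeasure r) (_ : r ≠ P.fst) (_ : klDiv r P.fst ≠ ∞),
    klDiv (condDistrib Prod.snd Prod.fst P ∘ₘ r) P.snd / klDiv r P.fst

/-- The functional `β₀[h]`, meant for square integrable `h` that is not almost surely constant. It
is `∞` when the denominator vanishes. Here `condDistrib Prod.fst Prod.snd P y` is `p(x|y)`. -/
def betaFunctional [StandardBorelSpace 𝒳] [Nonempty 𝒳]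
    (P : Measure (𝒳 × 𝒴)) [IsFiniteMeasure P] (h : 𝒳 → ℝ) : ℝ≥0∞ :=
  ENNReal.ofReal ((∫ x, h x ^ 2 ∂P.fst) - (∫ x, h x ∂P.fst) ^ 2) /
    ENNReal.ofReal ((∫ y, (∫ x, h x ∂(condDistrib Prod.fst Prod.snd P y)) ^ 2 ∂P.snd)
      - (∫ x, h x ∂P.fst) ^ 2)

/-- `sup_h 1 / β₀[h]` over all square integrable `h` that are not almost surely constant. -/
def supInvBetaFunctional [StandardBorelSpace 𝒳] [Nonempty 𝒳]
    (P : Measure (𝒳 × 𝒴)) [IsFiniteMeasure P] : ℝ≥0∞ :=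
  ⨆ (h : 𝒳 → ℝ) (_ : MemLp h 2 P.fst) (_ : ¬ ∃ c : ℝ, h =ᵐ[P.fst] fun _ ↦ c),
    (betaFunctional P h)⁻¹

/-- The Hirschfeld-Gebelein-Rényi maximal correlation `ρ_m(X;Y)`: the supremum of `E[f(X) g(Y)]`
over `f`, `g` with `E[f(X)] = E[g(Y)] = 0` and `E[f(X)²] = E[g(Y)²] = 1`, and `0` if there are no
such `f`, `g`. (The constraints are invariant under `f ↦ -f`, so negative values of `E[f(X) g(Y)]`
do not contribute to the supremum.) -/
def maximalCorrelation (P : Measure (𝒳 × 𝒴)) : ℝ≥0∞ :=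
  ⨆ (f : 𝒳 → ℝ) (g : 𝒴 → ℝ) (_ : MemLp f 2 P.fst) (_ : MemLp g 2 P.snd)
    (_ : ∫ x, f x ∂P.fst = 0) (_ : ∫ y, g y ∂P.snd = 0)
    (_ : ∫ x, f x ^ 2 ∂P.fst = 1) (_ : ∫ y, g y ^ 2 ∂P.snd = 1),
    ENNReal.ofReal (∫ w, f w.1 * g w.2 ∂P)

end Coefficients

end InfoBottleneck

end

/-! Everything reduces to a mixture formula. With `R z` $=p(x|z)$ and `K` $=p(y|x)$, $I(X;Z)=E_z
D(R_z\|p_x)$ and $I(Y;Z)=E_z D(KR_z\|p_y)$ (`infoXZ_eq_lintegral_klDiv`,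
`infoYZ_eq_lintegral_klDiv`). A trivial representation has objective $0$, so learnability at $\beta$
means that some ratio $I(Y;Z)/I(X;Z)$ exceeds $1/\beta$; this gives $1/\beta_0=\xi$.

Averaging the contraction inequality over $z$ gives $\xi\le\eta_{KL}$. Conversely, a law $r$ with
bounded density is realized as $p(x|z=1)$ for a binary $Z$ with $P(Z=1)=\varepsilon$. The
compensating law $p(x|z=0)$ is $O(\varepsilon)$-close to $p_x$ and costs only $O(\varepsilon^2)$ in
divergence, so dividing by $\varepsilon$ and letting $\varepsilon\to0$ isolates $r$. Truncation and
Fatou's lemma remove the boundedness.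

For $\sup_h 1/\beta_0[h]\le\eta_{KL}$, contraction is linearized at $r=(1+\varepsilon h)p_x$: the
image has density $1+\varepsilon E[h|Y]$, and divergence is half the second moment up to third
order. This yields $\mathrm{Var}\,E[h|Y]\le\eta_{KL}\mathrm{Var}\,h$. Since
$1/\beta_0[h]=\mathrm{Var}\,E[h|Y]/\mathrm{Var}\,h$, Cauchy–Schwarz in $g$ identifies its supremum
with $\rho_m^2$. -/

namespace InfoBottleneck

open Filter Topology

/-! ### Divergence of densities and of mixtures -/

section Divergence

variable {α β : Type*} [MeasurableSpace α] [MeasurableSpace β]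

lemma klDiv_withDensity (ν : Measure α) [IsFiniteMeasure ν] {f : α → ℝ≥0∞} (hf : Measurable f)
    (hf_fin : ∫⁻ x, f x ∂ν ≠ ∞) :
    klDiv (ν.withDensity f) ν = ∫⁻ x, ENNReal.ofReal (klFun (f x).toReal) ∂ν := by
  have := isFiniteMeasure_withDensity hf_fin
  rw [klDiv_eq_lintegral_klFun_of_ac (withDensity_absolutelyContinuous ν f)]
  refine lintegral_congr_ae ?_
  filter_upwards [Measure.rnDeriv_withDensity ν hf] with x hx
  rw [hx]

/-- The Kullback-Leibler divergence of a mixture of laws on the fibres is the average of the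
divergences on the fibres. -/
lemma klDiv_compProd_right [MeasurableSpace.CountableOrCountablyGenerated α β] (μ : Measure α)
    [IsFiniteMeasure μ] (κ η : Kernel α β) [IsFiniteKernel κ] [IsFiniteKernel η] :
    klDiv (μ ⊗ₘ κ) (μ ⊗ₘ η) = ∫⁻ a, klDiv (κ a) (η a) ∂μ := by
  by_cases hac : ∀ᵐ a ∂μ, κ a ≪ η a
  · have hm := Kernel.measurable_rnDeriv κ η
    have hκ : ∀ᵐ a ∂μ, κ a = η.withDensity (κ.rnDeriv η) a := by
      filter_upwards [hac] with a ha
      rw [← Kernel.singularPart_eq_zero_iff_absolutelyContinuous] at ha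
      conv_lhs => rw [← Kernel.rnDeriv_add_singularPart κ η]
      simp [ha]
    -- The absolutely continuous part is dominated by `κ`, so it inherits the bound of `κ`.
    have hfin : IsFiniteKernel (η.withDensity (κ.rnDeriv η)) := by
      refine ⟨κ.bound, Kernel.bound_lt_top κ, fun a ↦ ?_⟩
      refine le_trans ?_ (Kernel.measure_le_bound κ a Set.univ)
      conv_rhs => rw [← Kernel.rnDeriv_add_singularPart κ η]
      exact le_self_add
    have hcomp : μ ⊗ₘ κ = (μ ⊗ₘ η).withDensity fun w ↦ κ.rnDeriv η w.1 w.2 := by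
      rw [← Measure.compProd_withDensity hm]
      exact Measure.compProd_congr hκ
    have hint : ∫⁻ w, κ.rnDeriv η w.1 w.2 ∂(μ ⊗ₘ η) ≠ ∞ := by
      rw [← setLIntegral_univ, ← withDensity_apply _ MeasurableSet.univ, ← hcomp]
      exact measure_ne_top _ _
    rw [hcomp, klDiv_withDensity _ hm hint, Measure.lintegral_compProd (by fun_prop)]
    refine lintegral_congr_ae ?_
    filter_upwards [hκ] with a ha
    have h : κ a = (η a).withDensity (κ.rnDeriv η a) := by
      rw [← Kernel.withDensity_apply _ hm]; exact ha
    rw [h, klDiv_withDensity _ (Kernel.measurable_rnDeriv_right κ η a)]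
    rw [← setLIntegral_univ, ← withDensity_apply _ MeasurableSet.univ, ← h]
    exact measure_ne_top _ _
  -- Both sides are infinite: the fibres where absolute continuity fails have positive `μ`-measure.
  · rw [klDiv_of_not_ac (mt Measure.absolutelyContinuous_compProd_right_iff.1 hac)]
    have hS := (Kernel.measurableSet_absolutelyContinuous κ η).compl
    refine (top_le_iff.1 ?_).symm
    calc ∞ = ∫⁻ _ in {a | κ a ≪ η a}ᶜ, ∞ ∂μ := by
            rw [setLIntegral_const, ENNReal.top_mul]
            exact hac
      _ ≤ ∫⁻ a in {a | κ a ≪ η a}ᶜ, klDiv (κ a) (η a) ∂μ :=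
            setLIntegral_mono' hS fun a ha ↦ (klDiv_of_not_ac ha).ge
      _ ≤ ∫⁻ a, klDiv (κ a) (η a) ∂μ := setLIntegral_le_lintegral _ _

lemma klDiv_map_swap (μ ν : Measure (α × β)) [IsFiniteMeasure μ] [IsFiniteMeasure ν] :
    klDiv (μ.map Prod.swap) (ν.map Prod.swap) = klDiv μ ν := by
  refine le_antisymm (klDiv_map_le μ ν measurable_swap) ?_
  have := klDiv_map_le (μ.map Prod.swap) (ν.map Prod.swap) (measurable_swap (α := β) (β := α))
  simpa [Measure.map_map measurable_swap measurable_swap] using this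

end Divergence

/-! ### Disintegrations and the mixture formulas for mutual information -/

section Channel

variable {𝒳 𝒴 𝒵 : Type*} [MeasurableSpace 𝒳] [MeasurableSpace 𝒴] [MeasurableSpace 𝒵]
  (P : Measure (𝒳 × 𝒴)) [IsProbabilityMeasure P]

lemma fst_compProd_condDistrib [StandardBorelSpace 𝒴] [Nonempty 𝒴] :
    P.fst ⊗ₘ condDistrib Prod.snd Prod.fst P = P := by
  simpa using! compProd_map_condDistrib (X := Prod.fst) (Y := Prod.snd) (μ := P) (by fun_prop)

lemma snd_compProd_condDistrib [StandardBorelSpace 𝒳] [Nonempty 𝒳] :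
    P.snd ⊗ₘ condDistrib Prod.fst Prod.snd P = P.map Prod.swap :=
  compProd_map_condDistrib (X := Prod.snd) (Y := Prod.fst) (μ := P) (by fun_prop)

lemma condDistrib_comp_fst [StandardBorelSpace 𝒴] [Nonempty 𝒴] :
    condDistrib Prod.snd Prod.fst P ∘ₘ P.fst = P.snd :=
  condDistrib_comp_map (by fun_prop) (by fun_prop)

lemma condDistrib_comp_snd [StandardBorelSpace 𝒳] [Nonempty 𝒳] :
    condDistrib Prod.fst Prod.snd P ∘ₘ P.snd = P.fst :=
  condDistrib_comp_map (by fun_prop) (by fun_prop)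

lemma klDiv_condDistrib_comp_le [StandardBorelSpace 𝒴] [Nonempty 𝒴] (r : Measure 𝒳)
    [IsProbabilityMeasure r] :
    klDiv (condDistrib Prod.snd Prod.fst P ∘ₘ r) P.snd ≤ klDiv r P.fst := by
  conv_lhs => rw [← condDistrib_comp_fst P]
  exact klDiv_comp_right_le r P.fst _

/-- The channel `p(y|x)` acts on densities as the conditional expectation given `Y`. -/
lemma condDistrib_comp_withDensity [StandardBorelSpace 𝒳] [Nonempty 𝒳]
    [StandardBorelSpace 𝒴] [Nonempty 𝒴] {f : 𝒳 → ℝ≥0∞} (hf : Measurable f) :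
    condDistrib Prod.snd Prod.fst P ∘ₘ P.fst.withDensity f
      = P.snd.withDensity fun y ↦ ∫⁻ x, f x ∂(condDistrib Prod.fst Prod.snd P y) := by
  ext s hs
  rw [Measure.bind_apply hs (Kernel.aemeasurable _), withDensity_apply _ hs,
    lintegral_withDensity_eq_lintegral_mul _ hf (Kernel.measurable_coe _ hs)]
  -- Both sides equal $E[f(X)1_s(Y)]$, computed with the two disintegrations of `P`.
  have h1 : ∫⁻ x, (f * fun x ↦ condDistrib Prod.snd Prod.fst P x s) x ∂P.fst
      = ∫⁻ w, f w.1 * s.indicator 1 w.2 ∂P := by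
    conv_rhs => rw [← fst_compProd_condDistrib P]
    rw [Measure.lintegral_compProd (by fun_prop (disch := assumption))]
    refine lintegral_congr fun x ↦ ?_
    change f x * _ = ∫⁻ y, f x * s.indicator 1 y ∂_
    rw [lintegral_const_mul _ (by fun_prop (disch := assumption)), lintegral_indicator_one hs]
  have h2 : ∫⁻ y in s, ∫⁻ x, f x ∂(condDistrib Prod.fst Prod.snd P y) ∂P.snd
      = ∫⁻ w, f w.1 * s.indicator 1 w.2 ∂P := by
    have h3 : ∫⁻ w, f w.1 * s.indicator 1 w.2 ∂P
        = ∫⁻ w, f w.2 * s.indicator 1 w.1 ∂(P.map Prod.swap) := by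
      rw [lintegral_map (by fun_prop (disch := assumption)) measurable_swap]
      rfl
    rw [h3, ← snd_compProd_condDistrib P,
      Measure.lintegral_compProd (by fun_prop (disch := assumption)), ← lintegral_indicator hs]
    refine lintegral_congr fun y ↦ ?_
    change _ = ∫⁻ x, f x * s.indicator 1 y ∂_
    rw [lintegral_mul_const _ hf]
    by_cases hy : y ∈ s <;> simp [hy]
  rw [h1, h2]

lemma jointLaw_map_fst (κ : Kernel 𝒳 𝒵) [IsMarkovKernel κ] :
    (jointLaw P κ).map (fun w ↦ (w.1.1, w.2)) = P.fst ⊗ₘ κ := by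
  ext s hs
  rw [Measure.map_apply (by fun_prop) hs, jointLaw,
    Measure.compProd_apply (hs.preimage (by fun_prop)), Measure.compProd_apply hs, Measure.fst,
    lintegral_map (Kernel.measurable_kernel_prodMk_left hs) measurable_fst]
  rfl

/-- The Markov chain gives $p(y|z)=\int p(y|x)\,p(x|z)$. The backward kernel `R` is a parameter tied
to `κ` by `h`, so that one may start either from `κ` (with `R` its posterior) or from a prescribed
family $p(x|z)$ (with `κ` its posterior). -/
lemma jointLaw_map_snd [StandardBorelSpace 𝒴] [Nonempty 𝒴] {κ : Kernel 𝒳 𝒵} [IsMarkovKernel κ]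
    {π : Measure 𝒵} [IsProbabilityMeasure π] {R : Kernel 𝒵 𝒳} [IsMarkovKernel R]
    (h : P.fst ⊗ₘ κ = (π ⊗ₘ R).map Prod.swap) :
    (jointLaw P κ).map (fun w ↦ (w.1.2, w.2))
      = (π ⊗ₘ (condDistrib Prod.snd Prod.fst P ∘ₖ R)).map Prod.swap := by
  set K := condDistrib Prod.snd Prod.fst P
  have : IsProbabilityMeasure (jointLaw P κ) := by unfold jointLaw; infer_instance
  have := Measure.isProbabilityMeasure_map (μ := jointLaw P κ)
    (f := fun w : (𝒳 × 𝒴) × 𝒵 ↦ (w.1.2, w.2)) (by fun_prop)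
  refine Measure.ext_prod fun {A B} hA hB ↦ ?_
  have hKA := Kernel.measurable_coe K hA
  have hL : (jointLaw P κ).map (fun w ↦ (w.1.2, w.2)) (A ×ˢ B) = ∫⁻ x, K x A * κ x B ∂P.fst := by
    rw [Measure.map_apply (by fun_prop) (hA.prod hB), jointLaw]
    have : (fun w : (𝒳 × 𝒴) × 𝒵 ↦ (w.1.2, w.2)) ⁻¹' A ×ˢ B = (Prod.snd ⁻¹' A) ×ˢ B := by
      ext; simp
    rw [this, Measure.compProd_apply_prod (measurable_snd hA) hB, ← lintegral_indicator
      (measurable_snd hA)]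
    conv_lhs => rw [← fst_compProd_condDistrib P]
    rw [Measure.lintegral_compProd (Measurable.indicator
      (Kernel.measurable_coe _ hB) (measurable_snd hA))]
    refine lintegral_congr fun x ↦ ?_
    have (y : 𝒴) : (Prod.snd ⁻¹' A).indicator (fun a ↦ (κ.prodMkRight 𝒴) a B) (x, y)
        = A.indicator 1 y * κ x B := by
      by_cases hy : y ∈ A <;> simp [hy]
    simp_rw [this]
    rw [lintegral_mul_const _ (by fun_prop (disch := assumption)), lintegral_indicator_one hA]
  have hF : Measurable fun w : 𝒳 × 𝒵 ↦ K w.1 A * B.indicator 1 w.2 :=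
    (hKA.comp measurable_fst).mul ((measurable_one.indicator hB).comp measurable_snd)
  have hF' : Measurable fun w : 𝒵 × 𝒳 ↦ K w.2 A * B.indicator 1 w.1 := hF.comp measurable_swap
  rw [hL, Measure.map_apply measurable_swap (hA.prod hB), Set.preimage_swap_prod,
    Measure.compProd_apply_prod hB hA]
  calc ∫⁻ x, K x A * κ x B ∂P.fst = ∫⁻ w, K w.1 A * B.indicator 1 w.2 ∂(P.fst ⊗ₘ κ) := by
        rw [Measure.lintegral_compProd hF]
        refine lintegral_congr fun x ↦ ?_
        change _ = ∫⁻ z, K x A * B.indicator 1 z ∂_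
        rw [lintegral_const_mul _ (by fun_prop (disch := assumption)), lintegral_indicator_one hB]
    _ = ∫⁻ w, K w.2 A * B.indicator 1 w.1 ∂(π ⊗ₘ R) := by
        rw [h, lintegral_map hF measurable_swap]
        rfl
    _ = ∫⁻ z in B, (K ∘ₖ R) z A ∂π := by
        rw [Measure.lintegral_compProd hF', ← lintegral_indicator hB]
        refine lintegral_congr fun z ↦ ?_
        change ∫⁻ x, K x A * B.indicator 1 z ∂_ = _
        rw [lintegral_mul_const _ hKA]
        by_cases hz : z ∈ B <;> simp [hz, Kernel.comp_apply' _ _ _ hA]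

/-- A product measure is a composition with a constant kernel, so `klDiv_compProd_right` applies
after swapping the coordinates. -/
lemma infoXZ_eq_lintegral_klDiv [StandardBorelSpace 𝒳] {κ : Kernel 𝒳 𝒵} [IsMarkovKernel κ]
    {π : Measure 𝒵} [IsProbabilityMeasure π] {R : Kernel 𝒵 𝒳} [IsMarkovKernel R]
    (h : P.fst ⊗ₘ κ = (π ⊗ₘ R).map Prod.swap) :
    infoXZ P κ = ∫⁻ z, klDiv (R z) P.fst ∂π := by
  have hfst : (P.fst ⊗ₘ κ).fst = P.fst := Measure.fst_compProd _ _
  have hsnd : (P.fst ⊗ₘ κ).snd = π := by rw [h, Measure.snd_map_swap, Measure.fst_compProd]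
  rw [infoXZ, jointLaw_map_fst, mutualInfo, hfst, hsnd, h, ← Measure.prod_swap, klDiv_map_swap,
    ← Measure.compProd_const, klDiv_compProd_right]
  simp

lemma infoYZ_eq_lintegral_klDiv [StandardBorelSpace 𝒴] [Nonempty 𝒴] {κ : Kernel 𝒳 𝒵}
    [IsMarkovKernel κ] {π : Measure 𝒵} [IsProbabilityMeasure π] {R : Kernel 𝒵 𝒳} [IsMarkovKernel R]
    (h : P.fst ⊗ₘ κ = (π ⊗ₘ R).map Prod.swap) :
    infoYZ P κ = ∫⁻ z, klDiv (condDistrib Prod.snd Prod.fst P ∘ₘ R z) P.snd ∂π := by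
  set K := condDistrib Prod.snd Prod.fst P
  have hR : R ∘ₘ π = P.fst := by
    rw [← Measure.snd_compProd, ← Measure.fst_map_swap, ← h, Measure.fst_compProd]
  have hsnd : ((π ⊗ₘ (K ∘ₖ R)).map Prod.swap).snd = π := by
    rw [Measure.snd_map_swap, Measure.fst_compProd]
  have hfst : ((π ⊗ₘ (K ∘ₖ R)).map Prod.swap).fst = P.snd := by
    rw [Measure.fst_map_swap, Measure.snd_compProd, ← Measure.comp_assoc, hR,
      condDistrib_comp_fst]
  rw [infoYZ, jointLaw_map_snd P h, mutualInfo, hfst, hsnd, ← Measure.prod_swap, klDiv_map_swap,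
    ← Measure.compProd_const, klDiv_compProd_right]
  simp only [Kernel.comp_apply, Kernel.const_apply]
  rfl

/-- Data processing for the channel $p(y|x)$, applied for each $z$ and then averaged. -/
lemma infoYZ_le_infoXZ [StandardBorelSpace 𝒳] [Nonempty 𝒳] [StandardBorelSpace 𝒴] [Nonempty 𝒴]
    (κ : Kernel 𝒳 𝒵) [IsMarkovKernel κ] : infoYZ P κ ≤ infoXZ P κ := by
  have h : P.fst ⊗ₘ κ = ((κ ∘ₘ P.fst) ⊗ₘ posterior κ P.fst).map Prod.swap := by
    rw [compProd_posterior_eq_map_swap, Measure.map_map measurable_swap measurable_swap]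
    simp
  rw [infoXZ_eq_lintegral_klDiv P h, infoYZ_eq_lintegral_klDiv P h]
  exact lintegral_mono fun z ↦ klDiv_condDistrib_comp_le P _

lemma infoXZ_const (π : Measure 𝒵) [IsProbabilityMeasure π] :
    infoXZ P (Kernel.const 𝒳 π) = 0 := by
  rw [infoXZ, jointLaw_map_fst, mutualInfo, Measure.compProd_const]
  simp

/-! ### The learnability threshold -/

variable [StandardBorelSpace 𝒳] [Nonempty 𝒳] [StandardBorelSpace 𝒴] [Nonempty 𝒴]

lemma ibLearnable_iff (β : ℝ) :
    IBLearnable P β ↔ ∃ (𝒵 : Type) (_ : MeasurableSpace 𝒵) (κ : Kernel 𝒳 𝒵),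
      IsMarkovKernel κ ∧ infoXZ P κ ≠ ∞ ∧ (infoXZ P κ).toReal < β * (infoYZ P κ).toReal := by
  refine exists_congr fun 𝒵 ↦ exists_congr fun _ ↦ exists_congr fun κ ↦
    and_congr_right fun hκ ↦ and_congr_right fun _ ↦ ?_
  have h0 : infoXZ P (Kernel.const 𝒳 (κ ∘ₘ P.fst)) = 0 := infoXZ_const P _
  have h1 : infoYZ P (Kernel.const 𝒳 (κ ∘ₘ P.fst)) = 0 :=
    le_antisymm (h0 ▸ infoYZ_le_infoXZ P _) zero_le
  simp [ibObjective, h0, h1]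

theorem inv_learnabilityThreshold :
    (learnabilityThreshold P)⁻¹ = hypercontractivityCoeff P := by
  refine le_antisymm ?_ ?_
  · rw [ENNReal.inv_le_iff_inv_le]
    refine le_iInf₂ fun β hβ ↦ ?_
    rw [ENNReal.inv_le_iff_inv_le]
    obtain ⟨𝒵, _, κ, _, hfin, hlt⟩ := (ibLearnable_iff P β).1 hβ
    have hYfin : infoYZ P κ ≠ ∞ := ne_top_of_le_ne_top hfin (infoYZ_le_infoXZ P κ)
    have hY : 0 < (infoYZ P κ).toReal := by
      refine lt_of_le_of_ne ENNReal.toReal_nonneg fun h ↦ ?_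
      rw [← h, mul_zero] at hlt
      exact hlt.not_ge ENNReal.toReal_nonneg
    have hX : infoXZ P κ ≠ 0 := fun h ↦ by
      have := infoYZ_le_infoXZ P κ
      rw [h, nonpos_iff_eq_zero] at this
      simp [this] at hY
    have hβ0 : 0 < β := by
      by_contra! hβ0
      exact (hlt.trans_le (mul_nonpos_of_nonpos_of_nonneg hβ0 hY.le)).not_ge ENNReal.toReal_nonneg
    refine le_trans ?_ (le_iSup_of_le 𝒵 <| le_iSup_of_le _ <| le_iSup_of_le κ <|
      le_iSup_of_le ‹_› <| le_iSup_of_le hX <| le_iSup_of_le hfin le_rfl)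
    rw [ENNReal.le_div_iff_mul_le (.inl hX) (.inl hfin), mul_comm, ← div_eq_mul_inv]
    refine ENNReal.div_le_of_le_mul ?_
    rw [← ENNReal.ofReal_toReal hfin, ← ENNReal.ofReal_toReal hYfin, mul_comm,
      ← ENNReal.ofReal_mul hβ0.le]
    exact ENNReal.ofReal_le_ofReal hlt.le
  · refine iSup_le fun 𝒵 ↦ iSup_le fun _ ↦ iSup_le fun κ ↦ iSup_le fun _ ↦ iSup_le fun hX ↦
      iSup_le fun hfin ↦ ?_
    have hYfin : infoYZ P κ ≠ ∞ := ne_top_of_le_ne_top hfin (infoYZ_le_infoXZ P κ)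
    by_cases hY : infoYZ P κ = 0
    · simp [hY]
    rw [ENNReal.le_inv_iff_le_inv, ENNReal.inv_div (.inl hfin) (.inl hX)]
    have hx := ENNReal.toReal_pos hX hfin
    have hy := ENNReal.toReal_pos hY hYfin
    -- Learnability is a strict inequality, so it may fail for this `κ` at the exact ratio; it holds
    -- at every larger `β`.
    refine ENNReal.le_of_forall_pos_le_add fun ε hε _ ↦ ?_
    set β := (infoXZ P κ).toReal / (infoYZ P κ).toReal + ε with hβ
    have hlearn : IBLearnable P β := by
      refine (ibLearnable_iff P β).2 ⟨𝒵, _, κ, ‹_›, hfin, ?_⟩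
      rw [hβ, add_mul, div_mul_cancel₀ _ hy.ne']
      exact lt_add_of_pos_right _ (mul_pos (by exact_mod_cast hε) hy)
    refine (iInf₂_le β hlearn).trans_eq ?_
    rw [hβ, ENNReal.ofReal_add (by positivity) (by positivity), ENNReal.ofReal_div_of_pos hy,
      ENNReal.ofReal_toReal hfin, ENNReal.ofReal_toReal hYfin, ENNReal.ofReal_coe_nnreal]

end Channel

/-! ### Measurability of the divergence; truncation of densities -/

section Divergence

variable {α β : Type*} [MeasurableSpace α] [MeasurableSpace β]

/-- The kernel density `κ.rnDeriv η` is jointly measurable and agrees almost everywhere with the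
fibrewise Radon–Nikodym derivative. -/
lemma measurable_klDiv_kernel [MeasurableSpace.CountableOrCountablyGenerated α β]
    (κ η : Kernel α β) [IsFiniteKernel κ] [IsFiniteKernel η] :
    Measurable fun a ↦ klDiv (κ a) (η a) := by
  classical
  have h (a : α) : klDiv (κ a) (η a) = if a ∈ {a | κ a ≪ η a} then
      ∫⁻ b, ENNReal.ofReal (klFun (κ.rnDeriv η a b).toReal) ∂(η a) else ∞ := by
    rw [klDiv_eq_lintegral_klFun]
    refine if_congr Iff.rfl (lintegral_congr_ae ?_) rfl
    filter_upwards [Kernel.rnDeriv_eq_rnDeriv_measure (κ := κ) (η := η) (a := a)] with b hb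
    rw [hb]
  simp_rw [h]
  refine Measurable.ite (Kernel.measurableSet_absolutelyContinuous κ η) ?_ measurable_const
  exact Measurable.lintegral_kernel_prod_right (f := fun a b ↦
    ENNReal.ofReal (klFun (κ.rnDeriv η a b).toReal)) (by
      have := Kernel.measurable_rnDeriv κ η
      unfold Function.uncurry
      fun_prop)

lemma klDiv_withDensity_ofReal (ν : Measure α) [IsFiniteMeasure ν] {f : α → ℝ} (hf : Measurable f)
    (hf0 : ∀ x, 0 ≤ f x) (hint : Integrable f ν) :
    klDiv (ν.withDensity fun x ↦ ENNReal.ofReal (f x)) ν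
      = ∫⁻ x, ENNReal.ofReal (klFun (f x)) ∂ν := by
  rw [klDiv_withDensity ν (by fun_prop) hint.lintegral_lt_top.ne]
  simp_rw [ENNReal.toReal_ofReal (hf0 _)]

lemma isProbabilityMeasure_withDensity_ofReal {ν : Measure α} {f : α → ℝ} (hf0 : ∀ x, 0 ≤ f x)
    (hint : Integrable f ν) (h1 : ∫ x, f x ∂ν = 1) :
    IsProbabilityMeasure (ν.withDensity fun x ↦ ENNReal.ofReal (f x)) := by
  refine ⟨?_⟩
  rw [withDensity_apply _ MeasurableSet.univ, setLIntegral_univ,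
    ← ofReal_integral_eq_lintegral_ofReal hint (.of_forall hf0), h1, ENNReal.ofReal_one]

lemma klFun_le_sq {x : ℝ} (hx : 0 ≤ x) : klFun x ≤ (x - 1) ^ 2 := by
  rcases hx.eq_or_lt with rfl | hx
  · simp [klFun]
  · have := mul_le_mul_of_nonneg_left (Real.log_le_sub_one_of_pos hx) hx.le
    rw [klFun_apply]
    nlinarith

/-- `klFun` is convex with minimum $0$ at $1$, hence nondecreasing to the right of $1$. -/
lemma klFun_min_le {x a : ℝ} (ha : 1 ≤ a) (hx : 0 ≤ x) : klFun (min x a) ≤ klFun x := by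
  rcases le_total x a with h | h
  · rw [min_eq_left h]
  · rw [min_eq_right h]
    have := convexOn_klFun.le_max_of_mem_Icc (x := 1) (y := x) (z := a) (by simp) hx ⟨ha, h⟩
    rwa [klFun_one, max_eq_right (klFun_nonneg hx)] at this

lemma klFun_div (x : ℝ) {c : ℝ} (hc : 0 < c) :
    klFun (x / c) = c⁻¹ * klFun x + (1 - c⁻¹) - c⁻¹ * Real.log c * x := by
  rcases eq_or_ne x 0 with rfl | hx
  · simp [klFun]
  · rw [klFun_apply, klFun_apply, Real.log_div hx hc.ne']
    field_simp
    ring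

/-- Truncating a probability density `g` at height `a` and renormalizing it increases the
divergence by at most the normalizing factor. -/
lemma klDiv_truncation_le (ν : Measure α) [IsProbabilityMeasure ν] {g : α → ℝ} (hg : Measurable g)
    (hg0 : ∀ x, 0 ≤ g x) (hint : Integrable g ν) {a : ℝ} (ha : 1 ≤ a)
    (hc : 0 < ∫ x, min (g x) a ∂ν) :
    klDiv (ν.withDensity fun x ↦ ENNReal.ofReal (min (g x) a / ∫ x, min (g x) a ∂ν)) ν
      ≤ ENNReal.ofReal (∫ x, min (g x) a ∂ν)⁻¹
        * klDiv (ν.withDensity fun x ↦ ENNReal.ofReal (g x)) ν := by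
  set c := ∫ x, min (g x) a ∂ν with hcdef
  have hm0 (x : α) : 0 ≤ min (g x) a := le_min (hg0 x) (by linarith)
  have hmint : Integrable (fun x ↦ min (g x) a) ν := hint.inf (integrable_const a)
  have hkint : Integrable (fun x ↦ klFun (min (g x) a)) ν := by
    refine Integrable.of_bound (by fun_prop) ((a + 1) ^ 2) (.of_forall fun x ↦ ?_)
    rw [Real.norm_of_nonneg (klFun_nonneg (hm0 x))]
    refine (klFun_le_sq (hm0 x)).trans ?_
    have := min_le_right (g x) a
    have := hm0 x
    nlinarith
  have hdiv : Integrable (fun x ↦ klFun (min (g x) a / c)) ν := by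
    simp_rw [klFun_div _ hc]
    exact ((hkint.const_mul _).add (integrable_const _)).sub (hmint.const_mul _)
  rw [klDiv_withDensity_ofReal ν (by fun_prop) (fun x ↦ div_nonneg (hm0 x) hc.le)
    (hmint.div_const c), klDiv_withDensity_ofReal ν hg hg0 hint,
    ← ofReal_integral_eq_lintegral_ofReal hdiv
      (.of_forall fun x ↦ klFun_nonneg (div_nonneg (hm0 x) hc.le))]
  -- By `klFun_div` the difference of the two sides is $1-c^{-1}-\log c\le0$.
  have hval : ∫ x, klFun (min (g x) a / c) ∂ν ≤ c⁻¹ * ∫ x, klFun (min (g x) a) ∂ν := by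
    simp_rw [klFun_div _ hc]
    rw [integral_sub (by fun_prop) (by fun_prop), integral_add (by fun_prop) (by fun_prop),
      integral_const_mul, integral_const_mul, ← hcdef]
    have := Real.one_sub_inv_le_log_of_pos hc
    have hcc : c⁻¹ * Real.log c * c = Real.log c := by field_simp
    simp [hcc]
    linarith
  refine (ENNReal.ofReal_le_ofReal hval).trans ?_
  rw [ENNReal.ofReal_mul (by positivity), ofReal_integral_eq_lintegral_ofReal hkint
    (.of_forall fun x ↦ klFun_nonneg (hm0 x))]
  gcongr with x
  exact klFun_min_le ha (hg0 x)

end Divergence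

/-! ### Equality of the hypercontractivity and contraction coefficients -/

section Contraction

variable {𝒳 𝒴 : Type*} [MeasurableSpace 𝒳] [MeasurableSpace 𝒴] [StandardBorelSpace 𝒴] [Nonempty 𝒴]
  (P : Measure (𝒳 × 𝒴)) [IsProbabilityMeasure P]

lemma klDiv_comp_le_klContractionCoeff_mul (r : Measure 𝒳) [IsProbabilityMeasure r]
    (hr : klDiv r P.fst ≠ ∞) :
    klDiv (condDistrib Prod.snd Prod.fst P ∘ₘ r) P.snd ≤ klContractionCoeff P * klDiv r P.fst := by
  by_cases h : r = P.fst
  · rw [h, condDistrib_comp_fst]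
    simp
  · rw [← ENNReal.div_le_iff_le_mul (.inl (klDiv_eq_zero_iff.not.2 h)) (.inl hr)]
    exact le_iSup_of_le r <| le_iSup_of_le ‹_› <| le_iSup_of_le h <| le_iSup_of_le hr le_rfl

lemma klContractionCoeff_le_one : klContractionCoeff P ≤ 1 :=
  iSup_le fun r ↦ iSup_le fun _ ↦ iSup_le fun _ ↦ iSup_le fun _ ↦
    ENNReal.div_le_of_le_mul (by simpa using klDiv_condDistrib_comp_le P r)

variable [StandardBorelSpace 𝒳] [Nonempty 𝒳]

lemma hypercontractivityCoeff_le_one : hypercontractivityCoeff P ≤ 1 :=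
  iSup_le fun _ ↦ iSup_le fun _ ↦ iSup_le fun κ ↦ iSup_le fun _ ↦ iSup_le fun _ ↦ iSup_le fun _ ↦
    ENNReal.div_le_of_le_mul (by simpa using infoYZ_le_infoXZ P κ)

lemma infoYZ_le_hypercontractivityCoeff_mul {𝒵 : Type} [MeasurableSpace 𝒵] (κ : Kernel 𝒳 𝒵)
    [IsMarkovKernel κ] (hX : infoXZ P κ ≠ ∞) :
    infoYZ P κ ≤ hypercontractivityCoeff P * infoXZ P κ := by
  by_cases h : infoXZ P κ = 0
  · exact (infoYZ_le_infoXZ P κ).trans (by simp [h])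
  · rw [← ENNReal.div_le_iff_le_mul (.inl h) (.inl hX)]
    exact le_iSup_of_le 𝒵 <| le_iSup_of_le _ <| le_iSup_of_le κ <|
      le_iSup_of_le ‹_› <| le_iSup_of_le h <| le_iSup_of_le hX le_rfl

/-- Finiteness of $I(X;Z)$ makes $D(p(x|z)\|p(x))$ finite for almost every $z$, so contraction
applies to each $p(x|z)$ and integrates. -/
theorem hypercontractivityCoeff_le_klContractionCoeff :
    hypercontractivityCoeff P ≤ klContractionCoeff P := by
  refine iSup_le fun 𝒵 ↦ iSup_le fun _ ↦ iSup_le fun κ ↦ iSup_le fun _ ↦ iSup_le fun hX ↦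
    iSup_le fun hfin ↦ ?_
  rw [ENNReal.div_le_iff_le_mul (.inl hX) (.inl hfin)]
  have h : P.fst ⊗ₘ κ = ((κ ∘ₘ P.fst) ⊗ₘ posterior κ P.fst).map Prod.swap := by
    rw [compProd_posterior_eq_map_swap, Measure.map_map measurable_swap measurable_swap]
    simp
  rw [infoXZ_eq_lintegral_klDiv P h] at hfin
  rw [infoXZ_eq_lintegral_klDiv P h, infoYZ_eq_lintegral_klDiv P h]
  have hm : Measurable fun z ↦ klDiv (posterior κ P.fst z) P.fst :=
    measurable_klDiv_kernel (posterior κ P.fst) (Kernel.const 𝒵 P.fst)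
  rw [← lintegral_const_mul _ hm]
  refine lintegral_mono_ae ?_
  filter_upwards [ae_lt_top hm hfin] with z hz
  exact klDiv_comp_le_klContractionCoeff_mul P _ hz.ne

/-- The binary representation `Z` with `P(Z = 1) = ε` and `p(x|z=1) = f(x) p(x)` yields the
contraction inequality for `f(x) p(x)` up to an error of order `ε`. -/
lemma klDiv_comp_le_hypercontractivityCoeff_mul_add {f : 𝒳 → ℝ} (hf : Measurable f)
    (hf0 : ∀ x, 0 ≤ f x) {M : ℝ} (hfM : ∀ x, f x ≤ M) (hf1 : ∫ x, f x ∂P.fst = 1)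
    (hfin : klDiv (P.fst.withDensity fun x ↦ ENNReal.ofReal (f x)) P.fst ≠ ∞)
    {ε : ℝ} (hε : 0 < ε) (hε2 : ε ≤ 1 / 2) (hεM : ε * M ≤ 1) :
    klDiv (condDistrib Prod.snd Prod.fst P ∘ₘ
        P.fst.withDensity fun x ↦ ENNReal.ofReal (f x)) P.snd
      ≤ hypercontractivityCoeff P * klDiv (P.fst.withDensity fun x ↦ ENNReal.ofReal (f x)) P.fst
        + ENNReal.ofReal (4 * (1 + M) ^ 2 * ε) := by
  have hint : Integrable f P.fst := by
    by_contra h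
    simp [integral_undef h] at hf1
  have h1ε : 0 < 1 - ε := by linarith
  -- The density of $p(x|z=0)$, forced by $\varepsilon f+(1-\varepsilon)f_0=1$; it is nonnegative
  -- because $\varepsilon M\le1$.
  set f₀ : 𝒳 → ℝ := fun x ↦ (1 - ε * f x) / (1 - ε) with hf₀
  have hf₀m : Measurable f₀ := by fun_prop
  have hεf (x : 𝒳) : ε * f x ≤ 1 := (mul_le_mul_of_nonneg_left (hfM x) hε.le).trans hεM
  have hf₀0 (x : 𝒳) : 0 ≤ f₀ x := div_nonneg (by linarith [hεf x]) h1ε.le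
  have hint₀ : Integrable f₀ P.fst := ((integrable_const 1).sub (hint.const_mul ε)).div_const _
  have hf₀1 : ∫ x, f₀ x ∂P.fst = 1 := by
    rw [hf₀, integral_div, integral_sub (integrable_const 1) (hint.const_mul ε),
      integral_const_mul, hf1]
    simp [h1ε.ne']
  set r := P.fst.withDensity fun x ↦ ENNReal.ofReal (f x) with hr
  set r₀ := P.fst.withDensity fun x ↦ ENNReal.ofReal (f₀ x) with hr₀
  have : IsProbabilityMeasure r := isProbabilityMeasure_withDensity_ofReal hf0 hint hf1
  have : IsProbabilityMeasure r₀ := isProbabilityMeasure_withDensity_ofReal hf₀0 hint₀ hf₀1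
  set π : Measure Bool := ENNReal.ofReal ε • Measure.dirac true
    + ENNReal.ofReal (1 - ε) • Measure.dirac false with hπ
  have : IsProbabilityMeasure π := by
    refine ⟨?_⟩
    simp [hπ, ← ENNReal.ofReal_add hε.le h1ε.le]
  have hmix : Kernel.boolKernel r₀ r ∘ₘ π = P.fst := by
    rw [boolKernel_comp_measure]
    have hdens : (fun x ↦ ENNReal.ofReal ε * ENNReal.ofReal (f x)
        + ENNReal.ofReal (1 - ε) * ENNReal.ofReal (f₀ x)) = 1 := by
      ext x
      rw [← ENNReal.ofReal_mul hε.le, ← ENNReal.ofReal_mul h1ε.le,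
        ← ENNReal.ofReal_add (mul_nonneg hε.le (hf0 x)) (mul_nonneg h1ε.le (hf₀0 x)), hf₀]
      simp [mul_div_cancel₀ _ h1ε.ne']
    have : π {true} • r + π {false} • r₀ = P.fst.withDensity (fun x ↦
        ENNReal.ofReal ε * ENNReal.ofReal (f x)
          + ENNReal.ofReal (1 - ε) * ENNReal.ofReal (f₀ x)) := by
      rw [← Pi.add_def, withDensity_add_left (by fun_prop)]
      simp [hπ, hr, hr₀, ← withDensity_smul _ (show Measurable fun x ↦ ENNReal.ofReal (f x)
        by fun_prop), ← withDensity_smul _ (show Measurable fun x ↦ ENNReal.ofReal (f₀ x)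
        by fun_prop), Pi.smul_def]
    rw [this, hdens, withDensity_one]
  -- The representation is obtained by Bayes inversion of the prescribed $p(x|z)$.
  have hκ : P.fst ⊗ₘ posterior (Kernel.boolKernel r₀ r) π
      = (π ⊗ₘ Kernel.boolKernel r₀ r).map Prod.swap := by
    rw [← compProd_posterior_eq_map_swap, hmix]
  have hX := infoXZ_eq_lintegral_klDiv P hκ
  have hY := infoYZ_eq_lintegral_klDiv P hκ
  -- `klFun` is bounded by $(f_0-1)^2=\varepsilon^2(1-f)^2/(1-\varepsilon)^2$; the factor $4$ comes
  -- from $\varepsilon\le1/2$.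
  have hr₀le : klDiv r₀ P.fst ≤ ENNReal.ofReal (4 * (1 + M) ^ 2 * ε ^ 2) := by
    rw [hr₀, klDiv_withDensity_ofReal _ hf₀m hf₀0 hint₀]
    calc ∫⁻ x, ENNReal.ofReal (klFun (f₀ x)) ∂P.fst
        ≤ ∫⁻ x, ENNReal.ofReal (4 * (1 + M) ^ 2 * ε ^ 2) ∂P.fst := by
          refine lintegral_mono fun x ↦ ENNReal.ofReal_le_ofReal ?_
          refine (klFun_le_sq (hf₀0 x)).trans ?_
          have hx : f₀ x - 1 = ε * (1 - f x) / (1 - ε) := by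
            rw [hf₀]
            field_simp
            ring
          rw [hx, div_pow, div_le_iff₀ (by positivity), mul_pow]
          have h1 : (1 - f x) ^ 2 ≤ (1 + M) ^ 2 := by
            have := hf0 x
            have := hfM x
            exact sq_le_sq' (by linarith) (by linarith)
          have h2 : 1 ≤ 4 * (1 - ε) ^ 2 := by nlinarith
          calc ε ^ 2 * (1 - f x) ^ 2 ≤ ε ^ 2 * (1 + M) ^ 2 := by gcongr
            _ = (1 + M) ^ 2 * ε ^ 2 * 1 := by ring
            _ ≤ (1 + M) ^ 2 * ε ^ 2 * (4 * (1 - ε) ^ 2) := by gcongr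
            _ = _ := by ring
      _ = _ := by simp
  simp only [hπ, lintegral_add_measure, lintegral_smul_measure, lintegral_dirac,
    Kernel.boolKernel_true, Kernel.boolKernel_false, smul_eq_mul] at hX hY
  have hεne : ENNReal.ofReal ε ≠ 0 := by simpa using hε
  have hXle : infoXZ P (posterior (Kernel.boolKernel r₀ r) π)
      ≤ ENNReal.ofReal ε * (klDiv r P.fst + ENNReal.ofReal (4 * (1 + M) ^ 2 * ε)) := by
    rw [hX, mul_add, ← ENNReal.ofReal_mul hε.le]
    gcongr
    calc ENNReal.ofReal (1 - ε) * klDiv r₀ P.fst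
        ≤ 1 * ENNReal.ofReal (4 * (1 + M) ^ 2 * ε ^ 2) := by
          gcongr
          exact ENNReal.ofReal_le_one.2 (by linarith)
      _ = _ := by rw [one_mul]; congr 1; ring
  have hXfin : infoXZ P (posterior (Kernel.boolKernel r₀ r) π) ≠ ∞ :=
    ne_top_of_le_ne_top (by finiteness) hXle
  -- The term $z=0$ of $I(Y;Z)$ is dropped, and a common factor `ε` is kept for cancellation.
  have key : ENNReal.ofReal ε * klDiv (condDistrib Prod.snd Prod.fst P ∘ₘ r) P.snd
      ≤ ENNReal.ofReal ε * (hypercontractivityCoeff P * klDiv r P.fst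
        + ENNReal.ofReal (4 * (1 + M) ^ 2 * ε)) := by
    calc _ ≤ infoYZ P (posterior (Kernel.boolKernel r₀ r) π) := hY ▸ le_self_add
      _ ≤ hypercontractivityCoeff P * infoXZ P (posterior (Kernel.boolKernel r₀ r) π) :=
          infoYZ_le_hypercontractivityCoeff_mul P _ hXfin
      _ ≤ hypercontractivityCoeff P
          * (ENNReal.ofReal ε * (klDiv r P.fst + ENNReal.ofReal (4 * (1 + M) ^ 2 * ε))) := by
          gcongr
      _ = ENNReal.ofReal ε * (hypercontractivityCoeff P * klDiv r P.fst
          + hypercontractivityCoeff P * ENNReal.ofReal (4 * (1 + M) ^ 2 * ε)) := by ring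
      _ ≤ _ := by
          gcongr
          exact mul_le_of_le_one_left zero_le (hypercontractivityCoeff_le_one P)
  exact (ENNReal.mul_le_mul_iff_right hεne ENNReal.ofReal_ne_top).1 key

lemma klDiv_comp_le_hypercontractivityCoeff_mul_of_bounded {f : 𝒳 → ℝ} (hf : Measurable f)
    (hf0 : ∀ x, 0 ≤ f x) {M : ℝ} (hfM : ∀ x, f x ≤ M) (hf1 : ∫ x, f x ∂P.fst = 1)
    (hfin : klDiv (P.fst.withDensity fun x ↦ ENNReal.ofReal (f x)) P.fst ≠ ∞) :
    klDiv (condDistrib Prod.snd Prod.fst P ∘ₘ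
        P.fst.withDensity fun x ↦ ENNReal.ofReal (f x)) P.snd
      ≤ hypercontractivityCoeff P
        * klDiv (P.fst.withDensity fun x ↦ ENNReal.ofReal (f x)) P.fst := by
  have hlim : Tendsto (fun ε : ℝ ↦ hypercontractivityCoeff P
      * klDiv (P.fst.withDensity fun x ↦ ENNReal.ofReal (f x)) P.fst
        + ENNReal.ofReal (4 * (1 + M) ^ 2 * ε)) (𝓝[>] 0) (𝓝 (hypercontractivityCoeff P
      * klDiv (P.fst.withDensity fun x ↦ ENNReal.ofReal (f x)) P.fst + 0)) := by
    refine Tendsto.const_add _ ?_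
    have : Tendsto (fun ε : ℝ ↦ 4 * (1 + M) ^ 2 * ε) (𝓝[>] 0) (𝓝 (4 * (1 + M) ^ 2 * 0)) :=
      (Continuous.tendsto (by fun_prop) 0).mono_left nhdsWithin_le_nhds
    simpa using ENNReal.tendsto_ofReal this
  rw [add_zero] at hlim
  refine ge_of_tendsto hlim ?_
  have h1 : ∀ᶠ ε : ℝ in 𝓝[>] 0, ε ≤ 1 / 2 :=
    nhdsWithin_le_nhds (eventually_le_nhds (by norm_num))
  have h2 : ∀ᶠ ε : ℝ in 𝓝[>] 0, ε * M ≤ 1 := by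
    have : Tendsto (fun ε : ℝ ↦ ε * M) (𝓝[>] 0) (𝓝 (0 * M)) :=
      (Continuous.tendsto (by fun_prop) 0).mono_left nhdsWithin_le_nhds
    exact this.eventually_le_const (by simp)
  filter_upwards [h1, h2, self_mem_nhdsWithin] with ε h1 h2 h0
  exact klDiv_comp_le_hypercontractivityCoeff_mul_add P hf hf0 hfM hf1 hfin h0 h1 h2

/-- The density of `r` is truncated at `n` and renormalized by `c n`, which tends to $1$.
`klDiv_truncation_le` controls the input divergence; the output densities converge almost
everywhere, so Fatou's lemma controls the output. -/
lemma klDiv_comp_le_hypercontractivityCoeff_mul (r : Measure 𝒳) [IsProbabilityMeasure r]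
    (hr : klDiv r P.fst ≠ ∞) :
    klDiv (condDistrib Prod.snd Prod.fst P ∘ₘ r) P.snd
      ≤ hypercontractivityCoeff P * klDiv r P.fst := by
  set g : 𝒳 → ℝ := fun x ↦ (r.rnDeriv P.fst x).toReal with hgdef
  have hg : Measurable g := by fun_prop
  have hg0 (x : 𝒳) : 0 ≤ g x := ENNReal.toReal_nonneg
  have hint : Integrable g P.fst := Measure.integrable_toReal_rnDeriv
  have hac : r ≪ P.fst := (klDiv_ne_top_iff.1 hr).1
  have hrg : r = P.fst.withDensity fun x ↦ ENNReal.ofReal (g x) := by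
    conv_lhs => rw [← Measure.withDensity_rnDeriv_eq _ _ hac]
    refine withDensity_congr_ae ?_
    filter_upwards [Measure.rnDeriv_lt_top r P.fst] with x hx
    rw [hgdef, ENNReal.ofReal_toReal hx.ne]
  have hg1 : ∫ x, g x ∂P.fst = 1 := by
    rw [hgdef, Measure.integral_toReal_rnDeriv hac]
    simp
  set L := condDistrib Prod.fst Prod.snd P
  set K := condDistrib Prod.snd Prod.fst P
  set m : ℕ → 𝒳 → ℝ := fun n x ↦ min (g x) n with hm
  have hm0 (n : ℕ) (x : 𝒳) : 0 ≤ m n x := le_min (hg0 x) n.cast_nonneg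
  have hmm (n : ℕ) : Measurable (m n) := by fun_prop
  have hmint (n : ℕ) : Integrable (m n) P.fst := hint.inf (integrable_const _)
  have hmlim (x : 𝒳) : Tendsto (fun n ↦ m n x) atTop (𝓝 (g x)) := by
    refine tendsto_const_nhds.congr' ?_
    filter_upwards [tendsto_natCast_atTop_atTop.eventually_ge_atTop (g x)] with n hn
    exact (min_eq_left hn).symm
  set c : ℕ → ℝ := fun n ↦ ∫ x, m n x ∂P.fst with hc
  have hclim : Tendsto c atTop (𝓝 1) := by
    rw [← hg1]
    refine tendsto_integral_of_dominated_convergence g (fun n ↦ (hmint n).1) hint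
      (fun n ↦ .of_forall fun x ↦ ?_) (.of_forall hmlim)
    rw [Real.norm_of_nonneg (hm0 n x)]
    exact min_le_left _ _
  have hcinv : Tendsto (fun n ↦ ENNReal.ofReal (c n)⁻¹) atTop (𝓝 1) := by
    simpa using ENNReal.tendsto_ofReal (hclim.inv₀ one_ne_zero)
  have hLg (n : ℕ) (y : 𝒴) : ∫⁻ x, ENNReal.ofReal (m n x / c n) ∂(L y)
      = ENNReal.ofReal (c n)⁻¹ * ∫⁻ x, ENNReal.ofReal (m n x) ∂(L y) := by
    rw [← lintegral_const_mul _ (by fun_prop)]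
    refine lintegral_congr fun x ↦ ?_
    rw [div_eq_inv_mul, ENNReal.ofReal_mul (inv_nonneg.2 (integral_nonneg (hm0 n)))]
  -- Needed for continuity of `toReal` at the limiting output density.
  have hfinL : ∀ᵐ y ∂P.snd, ∫⁻ x, ENNReal.ofReal (g x) ∂(L y) < ∞ := by
    refine ae_lt_top (Measurable.lintegral_kernel (by fun_prop)) ?_
    rw [← setLIntegral_univ, ← withDensity_apply _ MeasurableSet.univ,
      ← condDistrib_comp_withDensity P (by fun_prop), ← hrg]
    exact measure_ne_top _ _
  have hpt : ∀ᵐ y ∂P.snd, Tendsto (fun n ↦ ENNReal.ofReal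
      (klFun (∫⁻ x, ENNReal.ofReal (m n x / c n) ∂(L y)).toReal)) atTop
      (𝓝 (ENNReal.ofReal (klFun (∫⁻ x, ENNReal.ofReal (g x) ∂(L y)).toReal))) := by
    filter_upwards [hfinL] with y hy
    have h1 : Tendsto (fun n ↦ ∫⁻ x, ENNReal.ofReal (m n x) ∂(L y)) atTop
        (𝓝 (∫⁻ x, ENNReal.ofReal (g x) ∂(L y))) := by
      refine lintegral_tendsto_of_tendsto_of_monotone (fun n ↦ by fun_prop)
        (.of_forall fun x i j hij ↦ ?_)
        (.of_forall fun x ↦ ENNReal.tendsto_ofReal (hmlim x))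
      exact ENNReal.ofReal_le_ofReal (min_le_min_left _ (by exact_mod_cast hij))
    have h2 := ENNReal.Tendsto.mul hcinv (.inl one_ne_zero) h1 (.inr ENNReal.one_ne_top)
    simp_rw [hLg]
    rw [one_mul] at h2
    exact ENNReal.tendsto_ofReal ((continuous_klFun.tendsto _).comp
      ((ENNReal.tendsto_toReal hy.ne).comp h2))
  have hKr : klDiv (K ∘ₘ r) P.snd
      = ∫⁻ y, ENNReal.ofReal (klFun (∫⁻ x, ENNReal.ofReal (g x) ∂(L y)).toReal) ∂P.snd := by
    rw [hrg, condDistrib_comp_withDensity P (by fun_prop), klDiv_withDensity _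
      (Measurable.lintegral_kernel (by fun_prop))]
    rw [← setLIntegral_univ, ← withDensity_apply _ MeasurableSet.univ,
      ← condDistrib_comp_withDensity P (by fun_prop), ← hrg]
    exact measure_ne_top _ _
  have hbound : ∀ᶠ n in atTop,
      ∫⁻ y, ENNReal.ofReal (klFun (∫⁻ x, ENNReal.ofReal (m n x / c n) ∂(L y)).toReal) ∂P.snd
        ≤ hypercontractivityCoeff P * (ENNReal.ofReal (c n)⁻¹ * klDiv r P.fst) := by
    filter_upwards [hclim.eventually_const_lt zero_lt_one, eventually_ge_atTop 1] with n hcn hn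
    have hd0 (x : 𝒳) : 0 ≤ m n x / c n := div_nonneg (hm0 n x) hcn.le
    have hd1 : ∫ x, m n x / c n ∂P.fst = 1 := by rw [integral_div, div_self hcn.ne']
    have htr : klDiv (P.fst.withDensity fun x ↦ ENNReal.ofReal (m n x / c n)) P.fst
        ≤ ENNReal.ofReal (c n)⁻¹ * klDiv r P.fst := by
      rw [hrg]
      exact klDiv_truncation_le P.fst hg hg0 hint (by exact_mod_cast hn) hcn
    have hprob := isProbabilityMeasure_withDensity_ofReal hd0 ((hmint n).div_const _) hd1
    have := klDiv_comp_le_hypercontractivityCoeff_mul_of_bounded P (f := fun x ↦ m n x / c n)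
      (by fun_prop) hd0 (M := n / c n) (fun x ↦ by gcongr; exact min_le_right _ _) hd1
      (ne_top_of_le_ne_top (by finiteness) htr)
    refine le_trans (le_of_eq ?_) (this.trans (by gcongr))
    rw [condDistrib_comp_withDensity P (by fun_prop), klDiv_withDensity _
      (Measurable.lintegral_kernel (by fun_prop))]
    rw [← setLIntegral_univ, ← withDensity_apply _ MeasurableSet.univ,
      ← condDistrib_comp_withDensity P (by fun_prop)]
    exact measure_ne_top _ _
  have hlim : Tendsto (fun n ↦ hypercontractivityCoeff P * (ENNReal.ofReal (c n)⁻¹ * klDiv r P.fst))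
      atTop (𝓝 (hypercontractivityCoeff P * (1 * klDiv r P.fst))) :=
    ENNReal.Tendsto.const_mul (ENNReal.Tendsto.mul_const hcinv (.inr hr))
      (.inr (ne_top_of_le_ne_top ENNReal.one_ne_top (hypercontractivityCoeff_le_one P)))
  have hmeas (n : ℕ) : Measurable fun y ↦ ENNReal.ofReal
      (klFun (∫⁻ x, ENNReal.ofReal (m n x / c n) ∂(L y)).toReal) := by
    have : Measurable fun y ↦ ∫⁻ x, ENNReal.ofReal (m n x / c n) ∂(L y) :=
      Measurable.lintegral_kernel (by fun_prop)
    fun_prop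
  calc klDiv (K ∘ₘ r) P.snd
      = ∫⁻ y, liminf (fun n ↦ ENNReal.ofReal
          (klFun (∫⁻ x, ENNReal.ofReal (m n x / c n) ∂(L y)).toReal)) atTop ∂P.snd := by
        rw [hKr]
        exact lintegral_congr_ae (hpt.mono fun y hy ↦ hy.liminf_eq.symm)
    _ ≤ liminf (fun n ↦ ∫⁻ y, ENNReal.ofReal
          (klFun (∫⁻ x, ENNReal.ofReal (m n x / c n) ∂(L y)).toReal) ∂P.snd) atTop :=
        lintegral_liminf_le hmeas
    _ ≤ liminf (fun n ↦ hypercontractivityCoeff P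
          * (ENNReal.ofReal (c n)⁻¹ * klDiv r P.fst)) atTop := liminf_le_liminf hbound
    _ = hypercontractivityCoeff P * klDiv r P.fst := by rw [hlim.liminf_eq, one_mul]

theorem hypercontractivityCoeff_eq_klContractionCoeff :
    hypercontractivityCoeff P = klContractionCoeff P := by
  refine le_antisymm (hypercontractivityCoeff_le_klContractionCoeff P) ?_
  refine iSup_le fun r ↦ iSup_le fun _ ↦ iSup_le fun hne ↦ iSup_le fun hr ↦ ?_
  rw [ENNReal.div_le_iff_le_mul (.inl (klDiv_eq_zero_iff.not.2 hne)) (.inl hr)]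
  exact klDiv_comp_le_hypercontractivityCoeff_mul P r hr

end Contraction

/-! ### Second-order expansion of the divergence -/

lemma abs_klFun_one_add_sub_le {u : ℝ} (hu : |u| ≤ 1 / 2) :
    |klFun (1 + u) - u ^ 2 / 2| ≤ 4 * |u| ^ 3 := by
  have h := Real.abs_log_sub_add_sum_range_le (x := -u) (by rw [abs_neg]; linarith) 2
  rw [Finset.sum_range_succ, Finset.sum_range_one, abs_neg] at h
  norm_num at h
  have hle : |u| ^ 3 / (1 - |u|) ≤ 2 * |u| ^ 3 := by
    rw [div_le_iff₀ (by linarith)]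
    nlinarith [pow_nonneg (abs_nonneg u) 3]
  -- The second-order Taylor remainder of $\log(1+u)$.
  set e := -u + u ^ 2 / 2 + Real.log (1 + u) with he
  have he2 : |e| ≤ 2 * |u| ^ 3 := h.trans hle
  have hk : klFun (1 + u) - u ^ 2 / 2 = -u ^ 3 / 2 + (1 + u) * e := by
    rw [klFun_apply, he]
    ring
  have h1 : |1 + u| ≤ 3 / 2 := (abs_add_le 1 u).trans (by rw [abs_one]; linarith)
  have h3 : |-u ^ 3 / 2| = |u| ^ 3 / 2 := by
    rw [abs_div, abs_neg, abs_pow]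
    norm_num
  rw [hk]
  calc |-u ^ 3 / 2 + (1 + u) * e| ≤ |-u ^ 3 / 2| + |1 + u| * |e| := by
        rw [← abs_mul]
        exact abs_add_le _ _
    _ ≤ |u| ^ 3 / 2 + 3 / 2 * (2 * |u| ^ 3) := by rw [h3]; gcongr
    _ ≤ _ := by nlinarith [pow_nonneg (abs_nonneg u) 3]

section SecondMoment

variable {α : Type*} [MeasurableSpace α]

lemma sq_integral_le_integral_sq {μ : Measure α} [IsProbabilityMeasure μ] {h : α → ℝ}
    (hh : MemLp h 2 μ) : (∫ x, h x ∂μ) ^ 2 ≤ ∫ x, h x ^ 2 ∂μ := by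
  have := variance_nonneg h μ
  rw [variance_eq_sub hh] at this
  simpa using this

lemma integral_sq_sub_pos {μ : Measure α} [IsProbabilityMeasure μ] {h : α → ℝ}
    (hh : MemLp h 2 μ) (hc : ¬ ∃ c : ℝ, h =ᵐ[μ] fun _ ↦ c) :
    0 < (∫ x, h x ^ 2 ∂μ) - (∫ x, h x ∂μ) ^ 2 := by
  have h1 : variance h μ = (∫ x, h x ^ 2 ∂μ) - (∫ x, h x ∂μ) ^ 2 := by
    rw [variance_eq_sub hh]
    simp
  rw [← h1]
  refine (variance_nonneg h μ).lt_of_ne fun h0 ↦ hc ⟨∫ x, h x ∂μ, ?_⟩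
  have := (evariance_eq_zero_iff hh.1.aemeasurable).1
    (by rw [← hh.ofReal_variance_eq, ← h0, ENNReal.ofReal_zero])
  exact this

lemma integrable_klFun_one_add {μ : Measure α} [IsProbabilityMeasure μ] {u : α → ℝ}
    (hu : AEStronglyMeasurable u μ) {M : ℝ} (hM : ∀ x, |u x| ≤ M) (hM2 : M ≤ 1 / 2) :
    Integrable (fun x ↦ klFun (1 + u x)) μ := by
  refine Integrable.of_bound (by
    exact continuous_klFun.comp_aestronglyMeasurable (aestronglyMeasurable_const.add hu)) (M ^ 2)
    (.of_forall fun x ↦ ?_)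
  have hx : 0 ≤ 1 + u x := by linarith [(abs_le.1 (hM x)).1]
  rw [Real.norm_of_nonneg (klFun_nonneg hx)]
  refine (klFun_le_sq hx).trans ?_
  rw [add_sub_cancel_left, ← sq_abs]
  gcongr
  exact hM x

lemma abs_integral_klFun_one_add_sub_le {μ : Measure α} [IsProbabilityMeasure μ] {u : α → ℝ}
    (hu : AEStronglyMeasurable u μ) {M : ℝ} (hM : ∀ x, |u x| ≤ M) (hM2 : M ≤ 1 / 2) :
    |(∫ x, klFun (1 + u x) ∂μ) - (∫ x, u x ^ 2 ∂μ) / 2| ≤ 4 * M ^ 3 := by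
  have hint := integrable_klFun_one_add hu hM hM2
  have hsq : Integrable (fun x ↦ u x ^ 2) μ :=
    (MemLp.of_bound hu M (.of_forall fun x ↦ hM x) (p := 2)).integrable_sq
  rw [← integral_div, ← integral_sub hint (hsq.div_const 2)]
  have hb (x : α) : ‖klFun (1 + u x) - u x ^ 2 / 2‖ ≤ 4 * M ^ 3 := by
    refine (abs_klFun_one_add_sub_le ((hM x).trans hM2)).trans ?_
    gcongr
    exact hM x
  simpa using norm_integral_le_of_norm_le_const (μ := μ) (.of_forall hb)

end SecondMoment

/-! ### Conditional expectation given $Y$ as integration against $p(x|y)$ -/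

section ConditionalExpectation

variable {𝒳 𝒴 : Type*} [MeasurableSpace 𝒳] [StandardBorelSpace 𝒳] [Nonempty 𝒳]
  [MeasurableSpace 𝒴] (P : Measure (𝒳 × 𝒴)) [IsProbabilityMeasure P]

variable {P} in
lemma ae_integrable_condDistrib {f : 𝒳 → ℝ} (hf : Integrable f P.fst) :
    ∀ᵐ y ∂P.snd, Integrable f (condDistrib Prod.fst Prod.snd P y) := by
  rw [← condDistrib_comp_snd P] at hf
  exact Measure.ae_integrable_of_integrable_comp hf

variable {P} in
lemma integrable_integral_condDistrib {f : 𝒳 → ℝ} (hf : Integrable f P.fst) :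
    Integrable (fun y ↦ ∫ x, f x ∂(condDistrib Prod.fst Prod.snd P y)) P.snd := by
  rw [← condDistrib_comp_snd P, Measure.comp_eq_comp_const_apply] at hf
  simpa using hf.integral_comp

variable {P} in
lemma integral_integral_condDistrib {f : 𝒳 → ℝ} (hf : Integrable f P.fst) :
    ∫ y, ∫ x, f x ∂(condDistrib Prod.fst Prod.snd P y) ∂P.snd = ∫ x, f x ∂P.fst := by
  rw [← condDistrib_comp_snd P, Measure.comp_eq_comp_const_apply] at hf
  conv_rhs => rw [← condDistrib_comp_snd P, Measure.comp_eq_comp_const_apply]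
  rw [Kernel.integral_comp hf, Kernel.const_apply]

variable {P} in
lemma ae_memLp_condDistrib {h : 𝒳 → ℝ} (hh : MemLp h 2 P.fst) :
    ∀ᵐ y ∂P.snd, MemLp h 2 (condDistrib Prod.fst Prod.snd P y) := by
  filter_upwards [ae_integrable_condDistrib hh.integrable_sq,
    ae_integrable_condDistrib (hh.integrable one_le_two)] with y h1 h2
  exact (memLp_two_iff_integrable_sq h2.1).2 h1

variable {P} in
-- Jensen's inequality for almost every $p(x|y)$.
lemma memLp_integral_condDistrib {h : 𝒳 → ℝ} (hh : MemLp h 2 P.fst) :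
    MemLp (fun y ↦ ∫ x, h x ∂(condDistrib Prod.fst Prod.snd P y)) 2 P.snd := by
  have hm := (integrable_integral_condDistrib (hh.integrable one_le_two)).1
  rw [memLp_two_iff_integrable_sq hm]
  refine (integrable_integral_condDistrib hh.integrable_sq).mono' (hm.pow 2) ?_
  filter_upwards [ae_memLp_condDistrib hh] with y hy
  rw [Real.norm_of_nonneg (sq_nonneg _)]
  exact sq_integral_le_integral_sq hy

variable {P} in
lemma integral_mul_eq_integral_condDistrib_mul {h : 𝒳 → ℝ} {g : 𝒴 → ℝ} (hh : MemLp h 2 P.fst)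
    (hg : MemLp g 2 P.snd) :
    ∫ w, h w.1 * g w.2 ∂P
      = ∫ y, (∫ x, h x ∂(condDistrib Prod.fst Prod.snd P y)) * g y ∂P.snd := by
  have hh' : MemLp (fun w : 𝒳 × 𝒴 ↦ h w.1) 2 P := hh.comp_measurePreserving
    (measurable_fst.measurePreserving P)
  have hg' : MemLp (fun w : 𝒳 × 𝒴 ↦ g w.2) 2 P := hg.comp_measurePreserving
    (measurable_snd.measurePreserving P)
  have hint : Integrable (fun w : 𝒳 × 𝒴 ↦ h w.1 * g w.2) P := hh'.integrable_mul hg'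
  have hswap : MeasurePreserving (Prod.swap : 𝒴 × 𝒳 → 𝒳 × 𝒴) (P.map Prod.swap) P :=
    ⟨measurable_swap, by simp [Measure.map_map measurable_swap measurable_swap]⟩
  have hint' : Integrable (fun w : 𝒴 × 𝒳 ↦ h w.2 * g w.1) (P.map Prod.swap) :=
    hswap.integrable_comp_of_integrable hint
  have : ∫ w, h w.1 * g w.2 ∂P = ∫ w, h w.2 * g w.1 ∂(P.map Prod.swap) :=
    (hswap.integral_comp' (f := MeasurableEquiv.prodComm) (fun w : 𝒳 × 𝒴 ↦ h w.1 * g w.2)).symm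
  rw [this]
  rw [← snd_compProd_condDistrib P] at hint' ⊢
  rw [Measure.integral_compProd hint']
  simp_rw [integral_mul_const]

end ConditionalExpectation

/-! ### Linearization of the contraction inequality -/

section Linearization

variable {𝒳 𝒴 : Type*} [MeasurableSpace 𝒳] [StandardBorelSpace 𝒳] [Nonempty 𝒳]
  [MeasurableSpace 𝒴] [StandardBorelSpace 𝒴] [Nonempty 𝒴]
  (P : Measure (𝒳 × 𝒴)) [IsProbabilityMeasure P]

/-- This is contraction for the law $(1+h)p_x$, whose image has density $1+E[h|Y]$ with respect to
$p_y$. -/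
lemma integral_klFun_condDistrib_le {h : 𝒳 → ℝ} (hh : Measurable h) {M : ℝ}
    (hM : ∀ x, |h x| ≤ M) (hM2 : M ≤ 1 / 2) (h0 : ∫ x, h x ∂P.fst = 0) :
    ∫ y, klFun (1 + ∫ x, h x ∂(condDistrib Prod.fst Prod.snd P y)) ∂P.snd
      ≤ (klContractionCoeff P).toReal * ∫ x, klFun (1 + h x) ∂P.fst := by
  set L := condDistrib Prod.fst Prod.snd P
  have hb (x : 𝒳) : 0 ≤ 1 + h x := by linarith [(abs_le.1 (hM x)).1]
  have hint (μ : Measure 𝒳) [IsProbabilityMeasure μ] : Integrable h μ :=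
    Integrable.of_bound hh.aestronglyMeasurable M (.of_forall hM)
  have hint1 (μ : Measure 𝒳) [IsProbabilityMeasure μ] : Integrable (fun x ↦ 1 + h x) μ :=
    (integrable_const 1).add (hint μ)
  have hLm : Measurable fun y ↦ ∫ x, h x ∂(L y) :=
    (hh.stronglyMeasurable.integral_kernel (κ := L)).measurable
  have hLM (y : 𝒴) : |∫ x, h x ∂(L y)| ≤ M := by
    simpa using norm_integral_le_of_norm_le_const (μ := L y) (f := h) (.of_forall hM)
  have hLb (y : 𝒴) : 0 ≤ 1 + ∫ x, h x ∂(L y) := by linarith [(abs_le.1 (hLM y)).1]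
  have h1 : ∫ x, 1 + h x ∂P.fst = 1 := by
    rw [integral_add (integrable_const 1) (hint _), h0]
    simp
  have hprob := isProbabilityMeasure_withDensity_ofReal hb (hint1 P.fst) h1
  have hkX := integrable_klFun_one_add (μ := P.fst) hh.aestronglyMeasurable hM hM2
  have hkY := integrable_klFun_one_add (μ := P.snd) hLm.aestronglyMeasurable hLM hM2
  have hX : klDiv (P.fst.withDensity fun x ↦ ENNReal.ofReal (1 + h x)) P.fst
      = ENNReal.ofReal (∫ x, klFun (1 + h x) ∂P.fst) := by
    rw [klDiv_withDensity_ofReal _ (by fun_prop) hb (hint1 _), ofReal_integral_eq_lintegral_ofReal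
      hkX (.of_forall fun x ↦ klFun_nonneg (hb x))]
  have hY : klDiv (condDistrib Prod.snd Prod.fst P ∘ₘ
      P.fst.withDensity fun x ↦ ENNReal.ofReal (1 + h x)) P.snd
      = ENNReal.ofReal (∫ y, klFun (1 + ∫ x, h x ∂(L y)) ∂P.snd) := by
    rw [condDistrib_comp_withDensity P (by fun_prop)]
    have (y : 𝒴) : ∫⁻ x, ENNReal.ofReal (1 + h x) ∂(L y)
        = ENNReal.ofReal (1 + ∫ x, h x ∂(L y)) := by
      rw [← ofReal_integral_eq_lintegral_ofReal (hint1 _) (.of_forall hb),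
        integral_add (integrable_const 1) (hint _)]
      simp
    simp_rw [L] at this
    simp_rw [this]
    rw [klDiv_withDensity_ofReal _ (by fun_prop) hLb, ofReal_integral_eq_lintegral_ofReal
      hkY (.of_forall fun x ↦ klFun_nonneg (hLb x))]
    exact (integrable_const 1).add (Integrable.of_bound hLm.aestronglyMeasurable M (.of_forall hLM))
  have key := klDiv_comp_le_klContractionCoeff_mul P _ (hX ▸ ENNReal.ofReal_ne_top)
  have hη : klContractionCoeff P ≠ ∞ :=
    ne_top_of_le_ne_top ENNReal.one_ne_top (klContractionCoeff_le_one P)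
  have hX0 : 0 ≤ ∫ x, klFun (1 + h x) ∂P.fst := integral_nonneg fun x ↦ klFun_nonneg (hb x)
  rw [hX, hY, ← ENNReal.ofReal_toReal hη, ← ENNReal.ofReal_mul ENNReal.toReal_nonneg] at key
  exact (ENNReal.ofReal_le_ofReal_iff (mul_nonneg ENNReal.toReal_nonneg hX0)).1 key

lemma integral_sq_condDistrib_le_of_bounded {h : 𝒳 → ℝ} (hh : Measurable h) {M : ℝ}
    (hM : ∀ x, |h x| ≤ M) (h0 : ∫ x, h x ∂P.fst = 0) :
    ∫ y, (∫ x, h x ∂(condDistrib Prod.fst Prod.snd P y)) ^ 2 ∂P.snd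
      ≤ (klContractionCoeff P).toReal * ∫ x, h x ^ 2 ∂P.fst := by
  set L := condDistrib Prod.fst Prod.snd P
  set η := (klContractionCoeff P).toReal
  have hη0 : 0 ≤ η := ENNReal.toReal_nonneg
  have hη1 : η ≤ 1 := by
    simpa using ENNReal.toReal_mono ENNReal.one_ne_top (klContractionCoeff_le_one P)
  -- The preceding inequality is used for $\varepsilon h$ and divided by $\varepsilon^2/2$. The
  -- cubic errors on the two sides are at most $4(\varepsilon M)^3$ each (as $\eta\le1$), whence
  -- $16M^3\varepsilon$.
  have hlim : Tendsto (fun ε : ℝ ↦ η * (∫ x, h x ^ 2 ∂P.fst) + 16 * M ^ 3 * ε) (𝓝[>] 0)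
      (𝓝 (η * (∫ x, h x ^ 2 ∂P.fst) + 16 * M ^ 3 * 0)) :=
    (Continuous.tendsto (by fun_prop) 0).mono_left nhdsWithin_le_nhds
  rw [mul_zero, add_zero] at hlim
  have hsmall : ∀ᶠ ε : ℝ in 𝓝[>] 0, ε * M ≤ 1 / 2 := by
    have : Tendsto (fun ε : ℝ ↦ ε * M) (𝓝[>] 0) (𝓝 (0 * M)) :=
      (Continuous.tendsto (by fun_prop) 0).mono_left nhdsWithin_le_nhds
    exact this.eventually_le_const (by norm_num)
  refine ge_of_tendsto hlim ?_
  filter_upwards [hsmall, self_mem_nhdsWithin] with ε hε2 hε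
  have hε : 0 < ε := hε
  have hεM (x : 𝒳) : |ε * h x| ≤ ε * M := by
    rw [abs_mul, abs_of_pos hε]
    exact mul_le_mul_of_nonneg_left (hM x) hε.le
  have hεL (y : 𝒴) : |∫ x, ε * h x ∂(L y)| ≤ ε * M := by
    simpa using norm_integral_le_of_norm_le_const (μ := L y) (f := fun x ↦ ε * h x)
      (.of_forall hεM)
  have hLm : Measurable fun y ↦ ∫ x, ε * h x ∂(L y) :=
    ((hh.const_mul ε).stronglyMeasurable.integral_kernel (κ := L)).measurable
  have h1 := integral_klFun_condDistrib_le P (hh.const_mul ε) hεM hε2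
    (by rw [integral_const_mul, h0, mul_zero])
  have h2 := abs_le.1 (abs_integral_klFun_one_add_sub_le (μ := P.fst)
    (hh.const_mul ε).aestronglyMeasurable hεM hε2)
  have h3 := abs_le.1 (abs_integral_klFun_one_add_sub_le (μ := P.snd)
    hLm.aestronglyMeasurable hεL hε2)
  simp_rw [L, integral_const_mul] at h3 h1
  simp_rw [mul_pow, integral_const_mul] at h2 h3
  have hM0 : 0 ≤ ε * M := (abs_nonneg _).trans (hεM (Classical.arbitrary 𝒳))
  have h4 := mul_le_mul_of_nonneg_left h2.2 hη0
  have h5 : η * (4 * (ε ^ 3 * M ^ 3)) ≤ 4 * (ε ^ 3 * M ^ 3) :=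
    mul_le_of_le_one_left (by rw [← mul_pow]; positivity) hη1
  have h6 : ε ^ 2 * ∫ y, (∫ x, h x ∂(condDistrib Prod.fst Prod.snd P y)) ^ 2 ∂P.snd
      ≤ ε ^ 2 * (η * (∫ x, h x ^ 2 ∂P.fst) + 16 * M ^ 3 * ε) := by
    nlinarith [h1, h3.1, h4, h5]
  exact le_of_mul_le_mul_left h6 (by positivity)

lemma integral_sub_const_sq {α : Type*} [MeasurableSpace α] {μ : Measure α}
    [IsProbabilityMeasure μ] {h : α → ℝ} (hh : MemLp h 2 μ) :
    ∫ x, (h x - ∫ z, h z ∂μ) ^ 2 ∂μ = (∫ x, h x ^ 2 ∂μ) - (∫ x, h x ∂μ) ^ 2 := by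
  rw [← variance_eq_integral hh.1.aemeasurable, variance_eq_sub hh]
  simp

lemma integral_sq_condDistrib_sub_le_of_bounded {h : 𝒳 → ℝ} (hh : Measurable h) {M : ℝ}
    (hM : ∀ x, |h x| ≤ M) :
    (∫ y, (∫ x, h x ∂(condDistrib Prod.fst Prod.snd P y)) ^ 2 ∂P.snd) - (∫ x, h x ∂P.fst) ^ 2
      ≤ (klContractionCoeff P).toReal * ((∫ x, h x ^ 2 ∂P.fst) - (∫ x, h x ∂P.fst) ^ 2) := by
  have hint (μ : Measure 𝒳) [IsProbabilityMeasure μ] : Integrable h μ :=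
    Integrable.of_bound hh.aestronglyMeasurable M (.of_forall hM)
  have hL2 : MemLp h 2 P.fst := MemLp.of_bound hh.aestronglyMeasurable M (.of_forall hM)
  have h1 := integral_sub_const_sq hL2
  have h2 := integral_sub_const_sq (memLp_integral_condDistrib hL2)
  rw [integral_integral_condDistrib (hint _)] at h2
  rw [← h1, ← h2]
  have hm : |∫ x, h x ∂P.fst| ≤ M := by
    simpa using norm_integral_le_of_norm_le_const (μ := P.fst) (f := h) (.of_forall hM)
  have key := integral_sq_condDistrib_le_of_bounded P (h := fun x ↦ h x - ∫ z, h z ∂P.fst)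
    (hh.sub_const _) (M := M + M) (fun x ↦ (abs_sub _ _).trans (add_le_add (hM x) hm)) (by
      rw [integral_sub (hint _) (integrable_const _)]
      simp)
  refine le_trans (le_of_eq ?_) key
  refine integral_congr_ae (.of_forall fun y ↦ ?_)
  simp only
  rw [integral_sub (hint _) (integrable_const _)]
  simp

/-- The variance of `E[h(X)|Y]` is at most `η_KL` times the variance of `h(X)`. -/
lemma integral_sq_condDistrib_sub_le {h : 𝒳 → ℝ} (hh : MemLp h 2 P.fst) :
    (∫ y, (∫ x, h x ∂(condDistrib Prod.fst Prod.snd P y)) ^ 2 ∂P.snd) - (∫ x, h x ∂P.fst) ^ 2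
      ≤ (klContractionCoeff P).toReal * ((∫ x, h x ^ 2 ∂P.fst) - (∫ x, h x ∂P.fst) ^ 2) := by
  set L := condDistrib Prod.fst Prod.snd P
  set g : 𝒳 → ℝ := hh.1.mk h with hg
  have hgm : Measurable g := hh.1.stronglyMeasurable_mk.measurable
  have hhg : h =ᵐ[P.fst] g := hh.1.ae_eq_mk
  have hgL2 : MemLp g 2 P.fst := hh.ae_eq hhg
  -- A $p_x$-null set is null for almost every $p(x|y)$, as $p_x$ is their mixture.
  have hLhg : ∀ᵐ y ∂P.snd, ∫ x, h x ∂(L y) = ∫ x, g x ∂(L y) := by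
    have := hhg
    rw [EventuallyEq, ← condDistrib_comp_snd P] at this
    filter_upwards [Measure.ae_ae_of_ae_comp this] with y hy
    exact integral_congr_ae hy
  rw [integral_congr_ae (hLhg.mono fun y hy ↦ congrArg (· ^ 2) hy), integral_congr_ae hhg,
    integral_congr_ae (hhg.mono fun x hx ↦ congrArg (· ^ 2) hx)]
  set t : ℕ → 𝒳 → ℝ := fun n x ↦ max (-(n : ℝ)) (min (g x) n) with ht
  have htm (n : ℕ) : Measurable (t n) := by fun_prop
  have htn (n : ℕ) (x : 𝒳) : |t n x| ≤ n :=
    abs_le.2 ⟨le_max_left _ _, max_le (by linarith [n.cast_nonneg (α := ℝ)]) (min_le_right _ _)⟩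
  have htg (n : ℕ) (x : 𝒳) : |t n x| ≤ |g x| := by
    have hn := n.cast_nonneg (α := ℝ)
    refine abs_le.2 ⟨?_, max_le (by linarith [abs_nonneg (g x)])
      ((min_le_left _ _).trans (le_abs_self _))⟩
    exact le_max_of_le_right (le_min (neg_abs_le _) (by linarith [abs_nonneg (g x)]))
  have htlim (x : 𝒳) : Tendsto (fun n ↦ t n x) atTop (𝓝 (g x)) := by
    refine tendsto_const_nhds.congr' ?_
    filter_upwards [tendsto_natCast_atTop_atTop.eventually_ge_atTop |g x|] with n hn
    have := abs_le.1 hn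
    rw [ht]
    simp only
    rw [min_eq_left this.2, max_eq_right this.1]
  have hgint := hgL2.integrable one_le_two
  have habs : MemLp (fun x ↦ |g x|) 2 P.fst := hgL2.abs
  have l1 : Tendsto (fun n ↦ ∫ x, t n x ∂P.fst) atTop (𝓝 (∫ x, g x ∂P.fst)) :=
    tendsto_integral_of_dominated_convergence (fun x ↦ |g x|)
      (fun n ↦ (htm n).aestronglyMeasurable) hgint.abs
      (fun n ↦ .of_forall (htg n)) (.of_forall htlim)
  have l2 : Tendsto (fun n ↦ ∫ x, t n x ^ 2 ∂P.fst) atTop (𝓝 (∫ x, g x ^ 2 ∂P.fst)) := by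
    refine tendsto_integral_of_dominated_convergence (fun x ↦ g x ^ 2)
      (fun n ↦ ((htm n).pow_const 2).aestronglyMeasurable) hgL2.integrable_sq
      (fun n ↦ .of_forall fun x ↦ ?_) (.of_forall fun x ↦ (htlim x).pow 2)
    rw [Real.norm_of_nonneg (sq_nonneg _)]
    exact sq_le_sq.2 (htg n x)
  -- Dominated convergence twice: by $|g|$ under almost every $p(x|y)$, then by $E[|g|\,|Y]^2$.
  have l3 : Tendsto (fun n ↦ ∫ y, (∫ x, t n x ∂(L y)) ^ 2 ∂P.snd) atTop
      (𝓝 (∫ y, (∫ x, g x ∂(L y)) ^ 2 ∂P.snd)) := by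
    refine tendsto_integral_of_dominated_convergence (fun y ↦ (∫ x, |g x| ∂(L y)) ^ 2)
      (fun n ↦ (((htm n).stronglyMeasurable.integral_kernel (κ := L)).measurable.pow_const
        2).aestronglyMeasurable) (memLp_integral_condDistrib habs).integrable_sq
      (fun n ↦ ?_) ?_
    · filter_upwards [ae_integrable_condDistrib hgint] with y hy
      rw [Real.norm_of_nonneg (sq_nonneg _)]
      refine sq_le_sq.2 ?_
      rw [abs_of_nonneg (integral_nonneg fun x ↦ abs_nonneg (g x) : 0 ≤ ∫ x, |g x| ∂(L y))]
      exact (abs_integral_le_integral_abs).trans (integral_mono_of_nonneg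
        (.of_forall fun x ↦ abs_nonneg _) hy.abs (.of_forall (htg n)))
    · filter_upwards [ae_integrable_condDistrib hgint] with y hy
      exact (tendsto_integral_of_dominated_convergence (fun x ↦ |g x|)
        (fun n ↦ (htm n).aestronglyMeasurable) hy.abs
        (fun n ↦ .of_forall (htg n)) (.of_forall htlim)).pow 2
  exact le_of_tendsto_of_tendsto' (l3.sub (l1.pow 2)) ((l2.sub (l1.pow 2)).const_mul _)
    fun n ↦ integral_sq_condDistrib_sub_le_of_bounded P (htm n) (htn n)

theorem supInvBetaFunctional_le_klContractionCoeff :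
    supInvBetaFunctional P ≤ klContractionCoeff P := by
  refine iSup_le fun h ↦ iSup_le fun hh ↦ iSup_le fun hc ↦ ?_
  have hV := integral_sq_sub_pos hh hc
  rw [betaFunctional, ENNReal.inv_div (.inl ENNReal.ofReal_ne_top)
    (.inr (ENNReal.ofReal_pos.2 hV).ne')]
  refine ENNReal.div_le_of_le_mul ?_
  have hη : klContractionCoeff P ≠ ∞ :=
    ne_top_of_le_ne_top ENNReal.one_ne_top (klContractionCoeff_le_one P)
  rw [← ENNReal.ofReal_toReal hη, ← ENNReal.ofReal_mul ENNReal.toReal_nonneg]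
  exact ENNReal.ofReal_le_ofReal (integral_sq_condDistrib_sub_le P hh)

end Linearization

/-! ### The functional $\beta_0[h]$ and maximal correlation -/

section MaximalCorrelation

variable {𝒳 𝒴 : Type*} [MeasurableSpace 𝒳] [StandardBorelSpace 𝒳] [Nonempty 𝒳]
  [MeasurableSpace 𝒴] (P : Measure (𝒳 × 𝒴)) [IsProbabilityMeasure P]

/-- For fixed $f$, the correlation is $E[E[f|Y]\,g]$, maximized by $g$ proportional to $E[f|Y]$ when
this is nonzero; the maximum squared is $1/\beta_0[f]$. -/
theorem supInvBetaFunctional_eq_maximalCorrelation_sq :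
    supInvBetaFunctional P = maximalCorrelation P ^ 2 := by
  set L := condDistrib Prod.fst Prod.snd P
  refine le_antisymm ?_ ?_
  · refine iSup_le fun h ↦ iSup_le fun hh ↦ iSup_le fun hc ↦ ?_
    have hV := integral_sq_sub_pos hh hc
    rw [betaFunctional, ENNReal.inv_div (.inl ENNReal.ofReal_ne_top)
      (.inr (ENNReal.ofReal_pos.2 hV).ne')]
    have hint := hh.integrable one_le_two
    have hLL2 := memLp_integral_condDistrib hh
    have hVeq := integral_sub_const_sq hh
    have hWeq := integral_sub_const_sq hLL2
    rw [integral_integral_condDistrib hint] at hWeq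
    set m := ∫ x, h x ∂P.fst with hm
    set V := (∫ x, h x ^ 2 ∂P.fst) - m ^ 2 with hVdef
    set W := (∫ y, (∫ x, h x ∂(L y)) ^ 2 ∂P.snd) - m ^ 2 with hWdef
    -- If $E[h|Y]$ has zero variance it cannot be normalized, but then $1/\beta_0[h]=0$.
    rcases le_or_gt W 0 with hW | hW
    · simp [ENNReal.ofReal_eq_zero.2 hW]
    have hf2 : MemLp (fun x ↦ (√V)⁻¹ * (h x - m)) 2 P.fst :=
      (hh.sub (memLp_const m)).const_mul _
    have hg2 : MemLp (fun y ↦ (√W)⁻¹ * ((∫ x, h x ∂(L y)) - m)) 2 P.snd :=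
      (hLL2.sub (memLp_const m)).const_mul _
    have hf0 : ∫ x, (√V)⁻¹ * (h x - m) ∂P.fst = 0 := by
      rw [integral_const_mul, integral_sub hint (integrable_const _)]
      simp [hm]
    have hg0 : ∫ y, (√W)⁻¹ * ((∫ x, h x ∂(L y)) - m) ∂P.snd = 0 := by
      rw [integral_const_mul, integral_sub (hLL2.integrable one_le_two) (integrable_const _),
        integral_integral_condDistrib hint]
      simp [hm]
    have hf1 : ∫ x, ((√V)⁻¹ * (h x - m)) ^ 2 ∂P.fst = 1 := by
      simp_rw [mul_pow, integral_const_mul]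
      rw [hVeq, inv_pow, Real.sq_sqrt hV.le, inv_mul_cancel₀ hV.ne']
    have hg1 : ∫ y, ((√W)⁻¹ * ((∫ x, h x ∂(L y)) - m)) ^ 2 ∂P.snd = 1 := by
      simp_rw [mul_pow, integral_const_mul]
      rw [hWeq, inv_pow, Real.sq_sqrt hW.le, inv_mul_cancel₀ hW.ne']
    have hcorr : ∫ w, (√V)⁻¹ * (h w.1 - m) * ((√W)⁻¹ * ((∫ x, h x ∂(L w.2)) - m)) ∂P
        = √(W / V) := by
      rw [integral_mul_eq_integral_condDistrib_mul hf2 hg2]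
      have : ∀ᵐ y ∂P.snd, (∫ x, (√V)⁻¹ * (h x - m) ∂(L y)) * ((√W)⁻¹ * ((∫ x, h x ∂(L y)) - m))
          = (√V)⁻¹ * (√W)⁻¹ * ((∫ x, h x ∂(L y)) - m) ^ 2 := by
        filter_upwards [ae_integrable_condDistrib hint] with y hy
        rw [integral_const_mul, integral_sub hy (integrable_const _)]
        simp
        ring
      rw [integral_congr_ae this, integral_const_mul, hWeq, Real.sqrt_div hW.le]
      nth_rewrite 2 [← Real.mul_self_sqrt hW.le]
      have := (Real.sqrt_pos.2 hW).ne'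
      field_simp
    have hle : ENNReal.ofReal √(W / V) ≤ maximalCorrelation P := by
      rw [← hcorr]
      exact le_iSup_of_le _ <| le_iSup_of_le _ <| le_iSup_of_le hf2 <| le_iSup_of_le hg2 <|
        le_iSup_of_le hf0 <| le_iSup_of_le hg0 <| le_iSup_of_le hf1 <| le_iSup_of_le hg1 le_rfl
    calc ENNReal.ofReal W / ENNReal.ofReal V = ENNReal.ofReal √(W / V) ^ 2 := by
          rw [← ENNReal.ofReal_pow (Real.sqrt_nonneg _), Real.sq_sqrt (by positivity),
            ENNReal.ofReal_div_of_pos hV]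
      _ ≤ maximalCorrelation P ^ 2 := by gcongr
  -- Taking the root leaves a bare supremum on the left, to be bounded pair by pair.
  · suffices maximalCorrelation P ≤ supInvBetaFunctional P ^ (2⁻¹ : ℝ) by
      calc maximalCorrelation P ^ 2 ≤ (supInvBetaFunctional P ^ (2⁻¹ : ℝ)) ^ 2 := by gcongr
        _ = supInvBetaFunctional P := by
          rw [← ENNReal.rpow_natCast, ← ENNReal.rpow_mul]
          simp
    refine iSup_le fun f ↦ iSup_le fun g ↦ iSup_le fun hf2 ↦ iSup_le fun hg2 ↦ iSup_le fun hf0 ↦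
      iSup_le fun hg0 ↦ iSup_le fun hf1 ↦ iSup_le fun hg1 ↦ ?_
    have hc : ¬ ∃ c : ℝ, f =ᵐ[P.fst] fun _ ↦ c := by
      rintro ⟨c, hc⟩
      rw [integral_congr_ae hc] at hf0
      rw [integral_congr_ae (hc.mono fun x hx ↦ congrArg (· ^ 2) hx)] at hf1
      simp at hf0 hf1
      simp [hf0] at hf1
    have hLL2 := memLp_integral_condDistrib hf2
    set c := ∫ w, f w.1 * g w.2 ∂P
    have hceq : c = ∫ y, (∫ x, f x ∂(L y)) * g y ∂P.snd :=
      integral_mul_eq_integral_condDistrib_mul hf2 hg2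
    -- Cauchy–Schwarz, from $E(E[f|Y]-cg)^2\ge0$ and $E[g^2]=1$.
    have hCS : c ^ 2 ≤ ∫ y, (∫ x, f x ∂(L y)) ^ 2 ∂P.snd := by
      have h0 : 0 ≤ ∫ y, ((∫ x, f x ∂(L y)) - c * g y) ^ 2 ∂P.snd :=
        integral_nonneg fun y ↦ sq_nonneg _
      have hexp : ∫ y, ((∫ x, f x ∂(L y)) - c * g y) ^ 2 ∂P.snd
          = (∫ y, (∫ x, f x ∂(L y)) ^ 2 ∂P.snd) - c ^ 2 := by
        have (y : 𝒴) : ((∫ x, f x ∂(L y)) - c * g y) ^ 2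
            = (∫ x, f x ∂(L y)) ^ 2 - 2 * c * ((∫ x, f x ∂(L y)) * g y) + c ^ 2 * g y ^ 2 := by
          ring
        simp_rw [this]
        have i1 : Integrable (fun y ↦ (∫ x, f x ∂(L y)) ^ 2) P.snd := hLL2.integrable_sq
        have i2 : Integrable (fun y ↦ (∫ x, f x ∂(L y)) * g y) P.snd := hLL2.integrable_mul hg2
        have i3 := hg2.integrable_sq
        rw [integral_add (by fun_prop) (by fun_prop), integral_sub (by fun_prop) (by fun_prop), integral_const_mul, integral_const_mul, hg1, ← hceq]
        ring
      linarith
    have hsq : ENNReal.ofReal c ^ 2 ≤ supInvBetaFunctional P := by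
      refine le_trans ?_ (le_iSup_of_le f <| le_iSup_of_le hf2 <| le_iSup_of_le hc le_rfl)
      rw [betaFunctional, hf0, hf1]
      simp only [ne_eq, OfNat.ofNat_ne_zero, not_false_eq_true, zero_pow, sub_zero,
        ENNReal.ofReal_one, one_div, inv_inv]
      -- `c` may be negative, in which case `ENNReal.ofReal c` is $0$.
      calc ENNReal.ofReal c ^ 2 ≤ ENNReal.ofReal |c| ^ 2 := by
            gcongr
            exact le_abs_self c
        _ = ENNReal.ofReal (c ^ 2) := by rw [← ENNReal.ofReal_pow (abs_nonneg c), sq_abs]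
        _ ≤ _ := ENNReal.ofReal_le_ofReal hCS
    rwa [ENNReal.le_rpow_inv_iff two_pos, ENNReal.rpow_two]

end MaximalCorrelation

end InfoBottleneck

theorem mainTheorem3 {𝒳 𝒴 : Type*}
    [MeasurableSpace 𝒳] [StandardBorelSpace 𝒳] [Nonempty 𝒳]
    [MeasurableSpace 𝒴] [StandardBorelSpace 𝒴] [Nonempty 𝒴]
    (P : Measure (𝒳 × 𝒴)) [IsProbabilityMeasure P] :
    (InfoBottleneck.learnabilityThreshold P)⁻¹ = InfoBottleneck.hypercontractivityCoeff P ∧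
    InfoBottleneck.hypercontractivityCoeff P = InfoBottleneck.klContractionCoeff P ∧
    InfoBottleneck.supInvBetaFunctional P ≤ InfoBottleneck.klContractionCoeff P ∧
    InfoBottleneck.supInvBetaFunctional P = InfoBottleneck.maximalCorrelation P ^ 2 :=
  ⟨InfoBottleneck.inv_learnabilityThreshold P,
    InfoBottleneck.hypercontractivityCoeff_eq_klContractionCoeff P,
    InfoBottleneck.supInvBetaFunctional_le_klContractionCoeff P,
    InfoBottleneck.supInvBetaFunctional_eq_maximalCorrelation_sq P⟩
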